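/- Let $q\ge 2$. A generalized P\'olya urn with $q$ colours is given by activities $a=(a_1,\dots,a_q)^T$ with $a_i\ge 0$, a deterministic initial vector $X_0\in\mathbb{R}_{\ge 0}^q$ with $a\cdot X_0>0$, and the laws of random vectors $\xi_1,\dots,\xi_q$ in $\mathbb{R}^q$. Put $S_n=a\cdot X_n$. Given $X_0,\dots,X_n$: if $S_n>0$, a colour $i$ is drawn with probability $a_iX_{n,i}/S_n$ and $X_{n+1}=X_n+\Delta X_n$, where, given that colour $i$ is drawn, $\Delta X_n$ has the law of $\xi_i$ independently of the past; if $S_n=0$, then $X_{n+1}=X_n$. Let $\mathcal{E}_n^c=\{S_k>0\text{ for all }0\le k\le n\}$, and write $\mathbb{E}[\,\cdot\,|\mathcal{E}_n^c]$ for expectation conditioned on this event. Let $A=(a_j\,\mathbb{E}\xi_{j,i})_{i,j=1}^q$ be the intensity matrix and $\sigma(A)$ its set of complex eigenvalues. For $\lambda\in\sigma(A)$ let $P_\lambda$ be the spectral projection, i.e. the projection of $\mathbb{C}^q$ onto the generalized eigenspace of $\lambda$ along the sum of the other generalized eigenspaces, and let $\nu_\lambda+1$ be the size of the largest Jordan block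 of $A$ for $\lambda$. For a random vector $Y$, $\|Y\|_p=(\mathbb{E}|Y|^p)^{1/p}$ with $|\cdot|$ the Euclidean norm. Let $p\ge 2$ be real and assume: the urn is tenable (for every $n$, almost surely all components of $X_n$ are non-negative); it is balanced in expectation, i.e. there is a constant $b>0$ with $\sum_{j}a_j\mathbb{E}\xi_{i,j}=b$ for every $i$ with $a_i>0$; the eigenvalue $\lambda_1=b$ of $A$ satisfies $\Re\lambda\le\lambda_1$ for all $\lambda\in\sigma(A)$; and $\|\xi_i\|_p<\infty$ for all $i$. Then for all $n\ge 0$, $\mathbb{P}(\mathcal{E}_n^c)>0$ and $X_n$ is integrable, so that the conditional expectations below are well defined, and there is a constant $C_p$, depending only on the urn (that is, on $q$, $a$, $X_0$ and the laws of the $\xi_i$) and on $p$, such that the following hold. (i) For all $\lambda\in\sigma(A)$ and all $n\ge 2$, \[ \left\lVert P_\lambda\left(X_n-\mathbb{E}[X_n|\mathcal{E}_n^c]\right)\mathbf{1}_{\mathcal{E}_n^c}\right\rVert_p\le \begin{cases} C_p\,n^{1/2} & \text{if }\Re\lambda<\lambda_1/2,\\ C_p\,n^{1/2}(\log n)^{\nu_\lambda+1}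 & \text{if }\Re\lambda=\lambda_1/2,\\ C_p\,n^{\Re\lambda/\lambda_1}(\log n)^{\nu_\lambda} & \text{if }\Re\lambda>\lambda_1/2. \end{cases} \] (ii) If $\lambda_1=b$ is a simple eigenvalue of $A$ (algebraic multiplicity one), then there is a unique $v_1\in\mathbb{C}^q$ with $Av_1=\lambda_1v_1$ and $a\cdot v_1=1$, and for all $n\ge 0$, \[ P_{\lambda_1}\left(X_n-\mathbb{E}[X_n|\mathcal{E}_n^c]\right)=\left(S_n-\mathbb{E}[S_n|\mathcal{E}_n^c]\right)v_1 \quad\text{and}\quad \left\lVert P_{\lambda_1}\left(X_n-\mathbb{E}[X_n|\mathcal{E}_n^c]\right)\mathbf{1}_{\mathcal{E}_n^c}\right\rVert_p\le C_p\sqrt{n}. \] -/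

import Mathlib

open MeasureTheory ProbabilityTheory

universe u

/-- The data of a generalized Pólya urn with `q` colours: the activities `a i ≥ 0`, the
deterministic initial composition `x₀` with positive total activity, and the joint law of the
replacement vector `ξ i` for each colour `i`. -/
structure PolyaUrn (q : ℕ) where
  a : EuclideanSpace ℝ (Fin q)
  a_nonneg : ∀ i, 0 ≤ a i
  x₀ : EuclideanSpace ℝ (Fin q)
  x₀_nonneg : ∀ i, 0 ≤ x₀ i
  x₀_active : 0 < ∑ i, a i * x₀ i
  ξ : Fin q → Measure (EuclideanSpace ℝ (Fin q))
  ξ_prob : ∀ i, IsProbabilityMeasure (ξ i)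

namespace PolyaUrn

variable {q : ℕ}

/-- The total activity `a · x` of a composition `x`. -/
def activity (U : PolyaUrn q) (x : EuclideanSpace ℝ (Fin q)) : ℝ :=
  ∑ i, U.a i * x i

open scoped Classical in
/-- The law of the change `ΔX` of the composition in one step from the composition `x`: if the
total activity is positive, a colour `i` is drawn with probability `a i * x i / (a · x)` and the
change has the law of `ξ i`; otherwise nothing is drawn and the change is `0`. -/
noncomputable def changeLaw (U : PolyaUrn q) (x : EuclideanSpace ℝ (Fin q)) :
    Measure (EuclideanSpace ℝ (Fin q)) :=
  if 0 < U.activity x then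
    ∑ i, ENNReal.ofReal (U.a i * x i / U.activity x) • U.ξ i
  else Measure.dirac 0

/-- The law of the composition at time `n`. -/
noncomputable def stateLaw (U : PolyaUrn q) : ℕ → Measure (EuclideanSpace ℝ (Fin q))
  | 0 => Measure.dirac U.x₀
  | n + 1 => (U.stateLaw n).bind fun x => (U.changeLaw x).map fun y => x + y

/-- `X` is a realization of the urn process on `(Ω, μ)`: it starts at `x₀` and the conditional
law of `X (n + 1) - X n` given `X 0, …, X n` is `changeLaw (X n)`. -/
structure IsRealization (U : PolyaUrn q) {Ω : Type*} [MeasurableSpace Ω] (μ : Measure Ω)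
    (X : ℕ → Ω → EuclideanSpace ℝ (Fin q)) : Prop where
  measurable : ∀ n, Measurable (X n)
  init : ∀ᵐ ω ∂μ, X 0 ω = U.x₀
  step : ∀ (n : ℕ) (B : Set (EuclideanSpace ℝ (Fin q))), MeasurableSet B →
    μ⟦{ω | X (n + 1) ω - X n ω ∈ B} |
        ⨆ k ∈ Set.Iic n, MeasurableSpace.comap (X k) inferInstance⟧
      =ᵐ[μ] fun ω => (U.changeLaw (X n ω)).real B

/-- The event of non-extinction up to time `n`. -/
def nonExtinct (U : PolyaUrn q) {Ω : Type*} (X : ℕ → Ω → EuclideanSpace ℝ (Fin q)) (n : ℕ) :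
    Set Ω :=
  {ω | ∀ k ≤ n, 0 < U.activity (X k ω)}

/-- Tenability: almost surely no component of the composition ever becomes negative. -/
def Tenable (U : PolyaUrn q) : Prop :=
  ∀ n, ∀ᵐ x ∂(U.stateLaw n), ∀ i, 0 ≤ x i

/-- Balanced in expectation, with constant `b > 0`. -/
def BalancedInExpectation (U : PolyaUrn q) (b : ℝ) : Prop :=
  0 < b ∧ ∀ i, 0 < U.a i → ∑ j, U.a j * ∫ y, y j ∂(U.ξ i) = b

/-- The intensity matrix, with `(i, j)` entry `a j * 𝔼 (ξ j) i`, over `ℂ`. -/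
noncomputable def intensity (U : PolyaUrn q) : Matrix (Fin q) (Fin q) ℂ :=
  Matrix.of fun i j => ((U.a j * ∫ y, y i ∂(U.ξ j) : ℝ) : ℂ)

/-- The condition `U_p`: the urn is tenable and balanced in expectation with constant `b`, no
eigenvalue of the intensity matrix has real part larger than `b` (so that `b`, which is itself
an eigenvalue, is the leading eigenvalue), and the replacement vectors lie in `L^p`. -/
structure Cond (U : PolyaUrn q) (b p : ℝ) : Prop where
  tenable : U.Tenable
  balanced : U.BalancedInExpectation b
  leading : ∀ z ∈ spectrum ℂ U.intensity, z.re ≤ b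
  moment : ∀ i, MemLp (fun y => y) (ENNReal.ofReal p) (U.ξ i)

end PolyaUrn

/-- A real vector regarded as a complex vector. -/
noncomputable def toComplexVec {q : ℕ} (x : EuclideanSpace ℝ (Fin q)) :
    EuclideanSpace ℂ (Fin q) :=
  WithLp.toLp 2 fun i => (x i : ℂ)

section Spectral

variable {V : Type*} [AddCommGroup V] [Module ℂ V] [FiniteDimensional ℂ V]

theorem isCompl_maxGenEigenspace (T : Module.End ℂ V) (z : ℂ) :
    IsCompl (T.maxGenEigenspace z) (⨆ (w : ℂ) (_ : w ≠ z), T.maxGenEigenspace w) := by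
  refine ⟨T.independent_maxGenEigenspace z, ?_⟩
  rw [codisjoint_iff, eq_top_iff, ← Module.End.iSup_maxGenEigenspace_eq_top T]
  refine iSup_le fun w => ?_
  by_cases h : w = z
  · subst h
    exact le_sup_left
  · exact le_sup_of_le_right
      (le_iSup₂ (f := fun (w : ℂ) (_ : w ≠ z) => T.maxGenEigenspace w) w h)

/-- The spectral projection of `T` at `z`: the projection onto the generalized eigenspace of
`z` along the sum of all the other generalized eigenspaces. -/
noncomputable def spectralProj (T : Module.End ℂ V) (z : ℂ) : Module.End ℂ V :=
  Submodule.projection _ _ (isCompl_maxGenEigenspace T z)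

/-- `ν` for the eigenvalue `z`: the exponent with `N ^ ν ≠ 0` and `N ^ (ν + 1) = 0`, where
`N = (T - z) P` is the nilpotent part of `T` at `z` and `P` the spectral projection. Thus `ν + 1`
is the size of the largest Jordan block of `T` for `z`. -/
noncomputable def jordanNu (T : Module.End ℂ V) (z : ℂ) : ℕ :=
  nilpotencyClass ((T - algebraMap ℂ (Module.End ℂ V) z) * spectralProj T z) - 1

end Spectral

/-- The intensity matrix acting on `ℂ^q`. -/
noncomputable def PolyaUrn.op {q : ℕ} (U : PolyaUrn q) :
    Module.End ℂ (EuclideanSpace ℂ (Fin q)) :=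
  Matrix.toEuclideanLin U.intensity

/-- The complex vector `X n ω - 𝔼[X n | non-extinction up to time n]`. -/
noncomputable def PolyaUrn.centered {q : ℕ} (U : PolyaUrn q) {Ω : Type*} [MeasurableSpace Ω]
    (μ : Measure Ω) (X : ℕ → Ω → EuclideanSpace ℝ (Fin q)) (n : ℕ) (ω : Ω) :
    EuclideanSpace ℂ (Fin q) :=
  toComplexVec (X n ω - ∫ ω', X n ω' ∂(μ[|U.nonExtinct X n]))

/-! Write `S_n` for the total activity and `w_n = a·x₀ + b n` for `scale`. While the urn is not
extinct, `X_{n+1} = X_n + A X_n / S_n + noise`, with conditionally centred noise. Replacing `S_n` by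
`w_n` makes the recursion linear with deterministic coefficients: `X_{n+1} = (1 + A / w_n) X_n +
noise + (1/S_n - 1/w_n) A X_n`. Hence, on non-extinction, `X_n` is a deterministic path plus
propagated noise plus propagated linearisation errors (`eq_add_of_mem_nonExtinct`).

Balance says that `a` is a left eigenvector of `A`, so `S_n - w_n` is exactly the activity of the
summed noise and is `O(√n)` in `L^p`. Tenability gives `|A X_n| ≤ const · S_n`, so the factor `S_n`
cancels and the error in step `n` is `O(n^{-1/2})` without any lower bound on `S_n`.

The noise is controlled by the 2-smoothness of a Hilbert space: a conditionally centred increment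
raises the squared `L^p` norm by at most a constant (`eLpNorm_add_noise_le`). This does the work of
a Burkholder inequality.

For propagation at an eigenvalue `z`, let `P` be the spectral projection and `N = (A - z) P`. The
vector `(L^m N^m P x)`, `0 ≤ m ≤ ν`, is nearly an eigenvector of the step: the step multiplies it by
`1 + z/w_n` and adds a shift of norm at most `1/(L w_n)` times its own norm. So it grows like `n^κ`
with `κ = Re z / b + 1/(L b)`, at the price of a factor `L^ν` (`norm_resolve_stepMap_le`). For `Re z
< b/2` a large fixed `L` keeps `κ < 1/2`. Otherwise `L = log n / log 2` makes `n^{1/(L b)}` bounded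
and `L^ν` becomes the logarithmic factor. At `Re z = b/2` the additional logarithm comes from
summing the linearisation errors.

Passing from the deterministic centring to the conditional mean costs a factor governed by `1 /
P(non-extinction)`, which is bounded because `K / (S_n⁺ + K)` is a supermartingale (`survival`). If
`b` is simple, its generalized eigenspace is a line on which `a` does not vanish, so `P x = (a·x)
v₁` and the `√n` bound for `S_n - w_n` is all that is needed. -/

/-! ### Smoothness of the `p`-th power of a Hilbert norm. -/

/-- Taylor's formula is unavailable near `-1`, where the second derivative blows up for `1 < r < 2`;
convexity is used instead. The interval `[-1, 3]` is the range of `‖m + y‖² / ‖m‖² - 1` when `‖y‖ ≤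
‖m‖`. -/
theorem one_add_rpow_le_quadratic {r : ℝ} (hr : 1 ≤ r) {x : ℝ} (h1 : -1 ≤ x) (h3 : x ≤ 3) :
    (1 + x) ^ r ≤ 1 + r * x + r * 4 ^ r * x ^ 2 := by
  have hv : 0 ≤ 1 + x := by linarith
  have h4 : 1 + 3 * r ≤ (4 : ℝ) ^ r := by
    have := one_add_mul_self_le_rpow_one_add (s := (3 : ℝ)) (by norm_num) hr
    norm_num at this
    linarith
  have hlow : 1 + r * x ≤ (1 + x) ^ r := one_add_mul_self_le_rpow_one_add h1 hr
  -- convexity: `(1+x)^r ≤ 1 + r x (1+x)^(r-1)`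
  have htan : (1 + x) ^ r ≤ 1 + r * x * (1 + x) ^ (r - 1) := by
    rcases hv.eq_or_lt with h0 | h0
    · rw [← h0, Real.zero_rpow (by linarith)]
      have hx : x = -1 := by linarith
      subst hx
      rcases hr.eq_or_lt with h | h
      · subst h; norm_num
      · rw [Real.zero_rpow (by linarith)]; norm_num
    · have hb := one_add_mul_self_le_rpow_one_add (s := -x / (1 + x)) (p := r)
        (by rw [le_div_iff₀ h0]; linarith) hr
      have h2 : 1 + -x / (1 + x) = (1 + x)⁻¹ := by field_simp; ring
      rw [h2, Real.inv_rpow hv] at hb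
      have hp : 0 < (1 + x) ^ r := Real.rpow_pos_of_pos h0 r
      have := mul_le_mul_of_nonneg_left hb hp.le
      rw [mul_inv_cancel₀ hp.ne'] at this
      have e : (1 + x) ^ r = (1 + x) ^ (r - 1) * (1 + x) := by
        rw [← Real.rpow_add_one h0.ne']; ring_nf
      have : (1 + x) ^ r * (1 + r * (-x / (1 + x))) = (1 + x) ^ r - r * x * (1 + x) ^ (r - 1) := by
        rw [e]; field_simp; ring
      linarith
  suffices h : x * ((1 + x) ^ (r - 1) - 1) ≤ 4 ^ r * x ^ 2 by
    nlinarith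
  rcases le_total 0 x with hx | hx
  · have hmono : (1 + x) ^ (r - 1) ≤ (1 + x) ^ r :=
      Real.rpow_le_rpow_of_exponent_le (by linarith) (by linarith)
    -- Convexity puts `(1 + x) ^ r` below the chord from `1` to `4`, whose slope is less than `4 ^
    -- r`.
    have hconv := (convexOn_rpow hr).2 (Set.mem_Ici.2 (zero_le_one' ℝ))
      (Set.mem_Ici.2 (zero_le_four (α := ℝ))) (sub_nonneg.2 (show x / 3 ≤ 1 by linarith))
      (by positivity : 0 ≤ x / 3) (by ring)
    simp only [smul_eq_mul, mul_one, Real.one_rpow] at hconv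
    have h5 : 1 - x / 3 + x / 3 * 4 = 1 + x := by ring
    rw [h5] at hconv
    have : (1 + x) ^ (r - 1) - 1 ≤ 4 ^ r * x := by nlinarith
    nlinarith
  · rcases hv.eq_or_lt with h0 | h0
    · have hx : x = -1 := by linarith
      subst hx
      have := Real.rpow_nonneg (show (0 : ℝ) ≤ 1 + -1 by norm_num) (r - 1)
      nlinarith
    have hmono : (1 + x) ^ r ≤ (1 + x) ^ (r - 1) :=
      Real.rpow_le_rpow_of_exponent_ge h0 (by linarith) (by linarith)
    have : -(4 ^ r * (-x)) ≤ (1 + x) ^ (r - 1) - 1 := by nlinarith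
    nlinarith

/-- The constant in the smoothness inequality for `‖·‖ ^ p` on a Hilbert space. -/
noncomputable def smoothConst (p : ℝ) : ℝ := 2 ^ p + p + p * 9 * 4 ^ (p / 2)

theorem smoothConst_pos {p : ℝ} (hp : 2 ≤ p) : 0 < smoothConst p := by
  unfold smoothConst; positivity

theorem norm_add_rpow_le {H : Type*} [NormedAddCommGroup H] [InnerProductSpace ℝ H] {p : ℝ}
    (hp : 2 ≤ p) (m y : H) :
    ‖m + y‖ ^ p ≤ ‖m‖ ^ p + p * ‖m‖ ^ (p - 2) * inner ℝ m y
      + smoothConst p * (‖m‖ ^ (p - 2) * ‖y‖ ^ 2 + ‖y‖ ^ p) := by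
  have hin : |inner ℝ m y| ≤ ‖m‖ * ‖y‖ := abs_real_inner_le_norm m y
  have hin' := neg_le_of_abs_le hin
  have hin'' := le_of_abs_le hin
  have hpm : 0 ≤ ‖m‖ ^ (p - 2) := by positivity
  have hyp : 0 ≤ ‖y‖ ^ p := by positivity
  have hp4 : 0 ≤ (4 : ℝ) ^ (p / 2) := by positivity
  have h2p : 0 ≤ (2 : ℝ) ^ p := by positivity
  rcases le_or_gt ‖m‖ ‖y‖ with hmy | hmy
  -- When `y` dominates, every term is at most a multiple of `‖y‖ ^ p`; this case needs the part `2
  -- ^ p + p` of `smoothConst`.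
  · have h1 : ‖m + y‖ ^ p ≤ 2 ^ p * ‖y‖ ^ p := by
      rw [← Real.mul_rpow (by norm_num) (norm_nonneg _)]
      exact Real.rpow_le_rpow (norm_nonneg _) ((norm_add_le m y).trans (by linarith)) (by linarith)
    have h2 : ‖m‖ ^ (p - 2) * (‖m‖ * ‖y‖) ≤ ‖y‖ ^ p := by
      calc ‖m‖ ^ (p - 2) * (‖m‖ * ‖y‖) ≤ ‖y‖ ^ (p - 2) * (‖y‖ * ‖y‖) := by
            gcongr
        _ = ‖y‖ ^ p := by
            rcases (norm_nonneg y).eq_or_lt with h | h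
            · rw [← h, Real.zero_rpow (by linarith : p ≠ 0)]; simp
            · rw [← sq, ← Real.rpow_natCast ‖y‖ 2, ← Real.rpow_add h]; norm_num
    have h3 : -(p * ‖y‖ ^ p) ≤ p * ‖m‖ ^ (p - 2) * inner ℝ m y := by
      have := mul_le_mul_of_nonneg_left hin' (mul_nonneg (by linarith : (0 : ℝ) ≤ p) hpm)
      nlinarith
    have h4 : (2 ^ p + p) * ‖y‖ ^ p ≤
        smoothConst p * (‖m‖ ^ (p - 2) * ‖y‖ ^ 2 + ‖y‖ ^ p) := by
      unfold smoothConst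
      have : 0 ≤ p * 9 * (4 : ℝ) ^ (p / 2) := by positivity
      have : 0 ≤ ‖m‖ ^ (p - 2) * ‖y‖ ^ 2 := by positivity
      exact mul_le_mul (by linarith) (by linarith) hyp (by positivity)
    have : 0 ≤ ‖m‖ ^ p := by positivity
    linarith
  · have hm : 0 < ‖m‖ := (norm_nonneg y).trans_lt hmy
    -- The relative change of the squared norm, so that the scalar inequality applies with exponent
    -- `p / 2`.
    set x : ℝ := (2 * inner ℝ m y + ‖y‖ ^ 2) / ‖m‖ ^ 2 with hx
    have hm2 : 0 < ‖m‖ ^ 2 := by positivity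
    have hsq : ‖m + y‖ ^ 2 = ‖m‖ ^ 2 * (1 + x) := by
      rw [norm_add_sq_real, hx]; field_simp; ring
    have hx1 : -1 ≤ x := by
      have : 0 ≤ ‖m‖ ^ 2 * (1 + x) := hsq ▸ sq_nonneg _
      have := nonneg_of_mul_nonneg_right this hm2
      linarith
    have hxm : x * ‖m‖ ^ 2 = 2 * inner ℝ m y + ‖y‖ ^ 2 := by rw [hx]; field_simp
    have hx3 : x ≤ 3 := by
      rw [hx, div_le_iff₀ hm2]
      nlinarith [norm_nonneg y]
    have hxsq : x ^ 2 * ‖m‖ ^ 2 ≤ 9 * ‖y‖ ^ 2 := by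
      have h : |x * ‖m‖ ^ 2| ≤ 3 * (‖m‖ * ‖y‖) := by
        rw [hxm, abs_le]
        constructor <;> nlinarith [norm_nonneg y]
      have h2 : (x * ‖m‖ ^ 2) ^ 2 ≤ (3 * (‖m‖ * ‖y‖)) ^ 2 :=
        sq_le_sq' (neg_le_of_abs_le h) (le_of_abs_le h)
      have : ‖m‖ ^ 2 * (x ^ 2 * ‖m‖ ^ 2) ≤ ‖m‖ ^ 2 * (9 * ‖y‖ ^ 2) := by nlinarith
      exact le_of_mul_le_mul_left this hm2
    have hq := one_add_rpow_le_quadratic (r := p / 2) (by linarith) hx1 hx3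
    have e1 : ‖m + y‖ ^ p = ‖m‖ ^ p * (1 + x) ^ (p / 2) := by
      have hh : ∀ z : H, ‖z‖ ^ p = (‖z‖ ^ 2) ^ (p / 2) := fun z => by
        rw [← Real.rpow_natCast, ← Real.rpow_mul (norm_nonneg _)]; congr 1; push_cast; ring
      rw [hh, hh, hsq, Real.mul_rpow hm2.le (by linarith)]
    have e2 : ‖m‖ ^ p = ‖m‖ ^ (p - 2) * ‖m‖ ^ 2 := by
      rw [← Real.rpow_natCast ‖m‖ 2, ← Real.rpow_add hm]; norm_num
    have h5 : ‖m + y‖ ^ p ≤ ‖m‖ ^ p + ‖m‖ ^ (p - 2) * (p / 2 * (x * ‖m‖ ^ 2))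
        + ‖m‖ ^ (p - 2) * (p / 2 * 4 ^ (p / 2) * (x ^ 2 * ‖m‖ ^ 2)) := by
      rw [e1]
      refine (mul_le_mul_of_nonneg_left hq (by positivity)).trans (le_of_eq ?_)
      rw [e2]; ring
    have h6 : ‖m‖ ^ (p - 2) * (p / 2 * 4 ^ (p / 2) * (x ^ 2 * ‖m‖ ^ 2)) ≤
        ‖m‖ ^ (p - 2) * (p / 2 * 4 ^ (p / 2) * (9 * ‖y‖ ^ 2)) := by gcongr
    rw [hxm] at h5
    have h7 : ‖m‖ ^ (p - 2) * (p / 2 * ‖y‖ ^ 2) + ‖m‖ ^ (p - 2) * (p / 2 * 4 ^ (p / 2) * (9 * ‖y‖ ^ 2))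
        ≤ smoothConst p * (‖m‖ ^ (p - 2) * ‖y‖ ^ 2 + ‖y‖ ^ p) := by
      have : 0 ≤ ‖m‖ ^ (p - 2) * ‖y‖ ^ 2 := by positivity
      have h8 : p / 2 + p / 2 * 4 ^ (p / 2) * 9 ≤ smoothConst p := by
        unfold smoothConst
        nlinarith
      have := mul_le_mul_of_nonneg_right h8 this
      have := mul_nonneg (smoothConst_pos hp).le hyp
      nlinarith
    nlinarith

theorem eLpNorm_ofReal_le_iff {α F : Type*} [MeasurableSpace α] [NormedAddCommGroup F]
    {μ : Measure α} {f : α → F} {p B : ℝ} (hp : 0 < p) (hB : 0 ≤ B) :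
    eLpNorm f (ENNReal.ofReal p) μ ≤ ENNReal.ofReal B ↔
      ∫⁻ x, ‖f x‖ₑ ^ p ∂μ ≤ ENNReal.ofReal (B ^ p) := by
  rw [eLpNorm_eq_lintegral_rpow_enorm_toReal (by simpa using hp) ENNReal.ofReal_ne_top,
    ENNReal.toReal_ofReal hp.le, one_div, ENNReal.rpow_inv_le_iff hp,
    ENNReal.ofReal_rpow_of_nonneg hB hp.le]

theorem enorm_rpow_eq_ofReal {F : Type*} [NormedAddCommGroup F] (x : F) {p : ℝ} (hp : 0 ≤ p) :
    ‖x‖ₑ ^ p = ENNReal.ofReal (‖x‖ ^ p) := by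
  rw [← ofReal_norm, ENNReal.ofReal_rpow_of_nonneg (norm_nonneg _) hp]

/-- Adding a centred variable to a constant vector raises the `p`-th moment by at most
a second-order term. -/
theorem lintegral_enorm_add_rpow_le {α H : Type*} [MeasurableSpace α] [NormedAddCommGroup H]
    [InnerProductSpace ℝ H] [CompleteSpace H] {ρ : Measure α} [IsProbabilityMeasure ρ]
    {Y : α → H} {p B : ℝ} (hp : 2 ≤ p) (hB : 0 ≤ B) (hY : MemLp Y (ENNReal.ofReal p) ρ)
    (h0 : ∫ y, Y y ∂ρ = 0) (hYB : eLpNorm Y (ENNReal.ofReal p) ρ ≤ ENNReal.ofReal B) (m : H) :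
    ∫⁻ y, ‖m + Y y‖ₑ ^ p ∂ρ ≤ ENNReal.ofReal
      (‖m‖ ^ p + smoothConst p * (‖m‖ ^ (p - 2) * B ^ 2 + B ^ p)) := by
  have hp0 : 0 < p := by linarith
  have hpp : (2 : ENNReal) ≤ ENNReal.ofReal p := by
    rw [← ENNReal.ofReal_ofNat]; exact ENNReal.ofReal_le_ofReal hp
  have hY2 : MemLp Y 2 ρ := hY.mono_exponent hpp
  have hY1 : Integrable Y ρ := hY2.integrable (by norm_num)
  have hmY : MemLp (fun y => m + Y y) (ENNReal.ofReal p) ρ := (memLp_const m).add hY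
  have hint : ∀ {f : α → H}, MemLp f (ENNReal.ofReal p) ρ →
      Integrable (fun y => ‖f y‖ ^ p) ρ := fun hf => by
    simpa [ENNReal.toReal_ofReal hp0.le] using
      hf.integrable_norm_rpow (by simpa using hp0) ENNReal.ofReal_ne_top
  have hi2 : Integrable (fun y => ‖Y y‖ ^ 2) ρ := hY2.integrable_norm_pow (by norm_num)
  have hin : Integrable (fun y => (inner ℝ m (Y y) : ℝ)) ρ := hY1.const_inner m
  have bp : ∫ y, ‖Y y‖ ^ p ∂ρ ≤ B ^ p := by
    have h := (eLpNorm_ofReal_le_iff hp0 hB).1 hYB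
    simp_rw [enorm_rpow_eq_ofReal _ hp0.le] at h
    rw [← ofReal_integral_eq_lintegral_ofReal (hint hY) (ae_of_all _ fun y => by positivity)] at h
    exact (ENNReal.ofReal_le_ofReal_iff (by positivity)).1 h
  have b2 : ∫ y, ‖Y y‖ ^ 2 ∂ρ ≤ B ^ 2 := by
    have h : eLpNorm Y (ENNReal.ofReal 2) ρ ≤ ENNReal.ofReal B :=
      (eLpNorm_le_eLpNorm_of_exponent_le (by simpa using hpp) hY.1).trans hYB
    have h := (eLpNorm_ofReal_le_iff two_pos hB).1 h
    simp_rw [enorm_rpow_eq_ofReal _ zero_le_two, Real.rpow_two] at h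
    rw [← ofReal_integral_eq_lintegral_ofReal hi2 (ae_of_all _ fun y => by positivity)] at h
    exact (ENNReal.ofReal_le_ofReal_iff (by positivity)).1 h
  simp_rw [enorm_rpow_eq_ofReal _ hp0.le]
  rw [← ofReal_integral_eq_lintegral_ofReal (hint hmY) (ae_of_all _ fun y => by positivity)]
  refine ENNReal.ofReal_le_ofReal ?_
  have hI1 : Integrable (fun y => ‖m‖ ^ p + p * ‖m‖ ^ (p - 2) * inner ℝ m (Y y)) ρ :=
    (integrable_const _).add (hin.const_mul _)
  have hI2 : Integrable (fun y => smoothConst p * (‖m‖ ^ (p - 2) * ‖Y y‖ ^ 2 + ‖Y y‖ ^ p)) ρ :=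
    ((hi2.const_mul _).add (hint hY)).const_mul _
  refine (integral_mono (hint hmY) (hI1.add hI2) fun y => norm_add_rpow_le hp m (Y y)).trans ?_
  simp only [Pi.add_apply]
  rw [integral_add hI1 hI2, integral_add (integrable_const _) (hin.const_mul _),
    integral_const_mul, integral_inner hY1, h0, integral_const_mul,
    integral_add (hi2.const_mul _) (hint hY), integral_const_mul]
  simp only [inner_zero_right, mul_zero, add_zero, integral_const, probReal_univ, one_smul]
  have := (smoothConst_pos hp).le
  gcongr

/-- Young's inequality with equality at `t = √u`. It is linear in `t ^ p`, so it can be integrated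
knowing only the `p`-th moment. -/
theorem rpow_sub_two_le {p t u : ℝ} (hp : 2 ≤ p) (ht : 0 ≤ t) (hu : 0 < u) :
    t ^ (p - 2) ≤ (1 - 2 / p) * t ^ p / u + 2 / p * u ^ (p / 2 - 1) := by
  have hp0 : 0 < p := by linarith
  have h := Real.geom_mean_le_arith_mean2_weighted (w₁ := 1 - 2 / p) (w₂ := 2 / p)
    (p₁ := t ^ p) (p₂ := u ^ (p / 2)) (sub_nonneg.2 ((div_le_one hp0).2 hp)) (by positivity)
    (by positivity) (by positivity) (by ring)
  rw [← Real.rpow_mul ht, ← Real.rpow_mul hu.le, show p * (1 - 2 / p) = p - 2 by field_simp,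
    show p / 2 * (2 / p) = 1 by field_simp, Real.rpow_one] at h
  have e : u ^ (p / 2) = u ^ (p / 2 - 1) * u := by
    rw [← Real.rpow_add_one hu.ne']; ring_nf
  rw [e] at h
  have : t ^ (p - 2) ≤ ((1 - 2 / p) * t ^ p + 2 / p * (u ^ (p / 2 - 1) * u)) / u :=
    (le_div_iff₀ hu).2 h
  refine this.trans (le_of_eq ?_)
  field_simp

/-- Turns the moment inequality into additivity of squared `L^p` norms, a form that can be iterated
over time. Positivity of `u` is needed for Young's inequality. -/
theorem eLpNorm_le_sqrt_of_smooth {Ω H : Type*} [MeasurableSpace Ω] [NormedAddCommGroup H]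
    {μ : Measure Ω} [IsProbabilityMeasure μ] {M Z : Ω → H} {p u B : ℝ} (hp : 2 ≤ p) (hu : 0 < u)
    (hB : 0 ≤ B) (hM : eLpNorm M (ENNReal.ofReal p) μ ≤ ENNReal.ofReal (√u))
    (hZ : ∫⁻ ω, ‖Z ω‖ₑ ^ p ∂μ ≤ ∫⁻ ω, ENNReal.ofReal
      (‖M ω‖ ^ p + smoothConst p * (‖M ω‖ ^ (p - 2) * B ^ 2 + B ^ p)) ∂μ) :
    eLpNorm Z (ENNReal.ofReal p) μ ≤ ENNReal.ofReal (√(u + 2 * smoothConst p * B ^ 2)) := by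
  have hp0 : 0 < p := by linarith
  have hC := smoothConst_pos hp
  have hC1 : 1 ≤ smoothConst p := by
    unfold smoothConst
    have : (0 : ℝ) ≤ 2 ^ p := by positivity
    have : (0 : ℝ) ≤ 4 ^ (p / 2) := by positivity
    nlinarith
  set C := smoothConst p
  have hsq : ∀ {v : ℝ}, 0 ≤ v → √v ^ p = v ^ (p / 2) := fun hv => by
    rw [Real.sqrt_eq_rpow, ← Real.rpow_mul hv]; congr 1; ring
  rw [eLpNorm_ofReal_le_iff hp0 (Real.sqrt_nonneg _), hsq hu.le] at hM
  rw [eLpNorm_ofReal_le_iff hp0 (Real.sqrt_nonneg _), hsq (by positivity)]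
  simp_rw [enorm_rpow_eq_ofReal _ hp0.le] at hM
  set α : ℝ := 1 + C * B ^ 2 * ((1 - 2 / p) / u)
  set β : ℝ := C * B ^ 2 * (2 / p * u ^ (p / 2 - 1)) + C * B ^ p
  have h12 : 0 ≤ 1 - 2 / p := sub_nonneg.2 ((div_le_one hp0).2 hp)
  have hα : 0 ≤ α := by positivity
  have hβ : 0 ≤ β := by positivity
  have hBp : 0 ≤ B ^ p := by positivity
  have hur : 0 < u ^ (p / 2 - 1) := by positivity
  have e : u ^ (p / 2) = u ^ (p / 2 - 1) * u := by
    rw [← Real.rpow_add_one hu.ne']; ring_nf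
  calc ∫⁻ ω, ‖Z ω‖ₑ ^ p ∂μ
      ≤ ∫⁻ ω, (ENNReal.ofReal α * ENNReal.ofReal (‖M ω‖ ^ p) + ENNReal.ofReal β) ∂μ := by
        refine hZ.trans (lintegral_mono fun ω => ?_)
        rw [← ENNReal.ofReal_mul hα, ← ENNReal.ofReal_add (by positivity) hβ]
        refine ENNReal.ofReal_le_ofReal ?_
        have := mul_le_mul_of_nonneg_left (rpow_sub_two_le hp (norm_nonneg (M ω)) hu)
          (show 0 ≤ C * B ^ 2 by positivity)
        simp only [α, β]
        calc _ = ‖M ω‖ ^ p + C * B ^ 2 * ‖M ω‖ ^ (p - 2) + C * B ^ p := by ring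
          _ ≤ _ := add_le_add_left (add_le_add_right this _) _
          _ = _ := by ring
    _ ≤ ENNReal.ofReal (α * u ^ (p / 2) + β) := by
        rw [lintegral_add_right _ measurable_const, lintegral_const_mul' _ _ ENNReal.ofReal_ne_top,
          lintegral_const, measure_univ, mul_one, ENNReal.ofReal_add (by positivity) hβ,
          ENNReal.ofReal_mul hα]
        gcongr
    _ ≤ ENNReal.ofReal ((u + 2 * C * B ^ 2) ^ (p / 2)) := by
        refine ENNReal.ofReal_le_ofReal ?_
        -- The factor 2 in `2 * C * B ^ 2` allows two lower bounds for the right side to be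
        -- averaged: superadditivity pays for `C * B ^ p`, and Bernoulli (`h2`) pays for the mixed
        -- term.
        have h1 : u ^ (p / 2) + (2 * C * B ^ 2) ^ (p / 2) ≤ (u + 2 * C * B ^ 2) ^ (p / 2) :=
          Real.add_rpow_le_rpow_add hu.le (by positivity) (by linarith)
        have h2 : u ^ (p / 2) + p / 2 * (2 * C * B ^ 2) * u ^ (p / 2 - 1)
            ≤ (u + 2 * C * B ^ 2) ^ (p / 2) := by
          have := one_add_mul_self_le_rpow_one_add (s := 2 * C * B ^ 2 / u) (p := p / 2)
            (by have : 0 ≤ 2 * C * B ^ 2 / u := by positivity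
                linarith) (by linarith)
          have := mul_le_mul_of_nonneg_left this (show 0 ≤ u ^ (p / 2) by positivity)
          rw [← Real.mul_rpow hu.le (by positivity),
            show u * (1 + 2 * C * B ^ 2 / u) = u + 2 * C * B ^ 2 by field_simp] at this
          refine le_trans (le_of_eq ?_) this
          rw [e]; field_simp
        have h3 : 2 * C * B ^ p ≤ (2 * C * B ^ 2) ^ (p / 2) := by
          have hBB : (B ^ 2) ^ (p / 2) = B ^ p := by
            rw [← Real.rpow_natCast, ← Real.rpow_mul hB]; congr 1; push_cast; ring
          rw [Real.mul_rpow (by positivity) (by positivity), hBB]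
          gcongr
          exact Real.self_le_rpow_of_one_le (by linarith) (by linarith)
        have h4 : C * B ^ 2 * u ^ (p / 2 - 1) ≤ p / 2 * (C * B ^ 2) * u ^ (p / 2 - 1) := by
          have : 0 ≤ C * B ^ 2 * u ^ (p / 2 - 1) := by positivity
          nlinarith
        have h5 : α * u ^ (p / 2) + β =
            u ^ (p / 2) + C * B ^ 2 * u ^ (p / 2 - 1) + C * B ^ p := by
          simp only [α, β]
          rw [e]; field_simp; ring
        rw [h5]
        nlinarith

/-! ### The urn as a Markov chain: integrating out one step. -/

namespace PolyaUrn

variable {q : ℕ}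

/-- The total activity as a continuous linear functional. -/
noncomputable def activityCLM (U : PolyaUrn q) : EuclideanSpace ℝ (Fin q) →L[ℝ] ℝ :=
  LinearMap.toContinuousLinearMap
    { toFun := U.activity
      map_add' := fun x y => by simp [activity, mul_add, Finset.sum_add_distrib]
      map_smul' := fun c x => by
        simp only [activity, PiLp.smul_apply, smul_eq_mul, RingHom.id_apply, Finset.mul_sum]
        exact Finset.sum_congr rfl fun i _ => by ring }

@[simp]
theorem activityCLM_apply (U : PolyaUrn q) (x : EuclideanSpace ℝ (Fin q)) :
    U.activityCLM x = U.activity x := rfl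

theorem measurable_activity (U : PolyaUrn q) : Measurable U.activity :=
  U.activityCLM.continuous.measurable

theorem activity_add (U : PolyaUrn q) (x y : EuclideanSpace ℝ (Fin q)) :
    U.activity (x + y) = U.activity x + U.activity y := U.activityCLM.map_add x y

theorem activity_sub (U : PolyaUrn q) (x y : EuclideanSpace ℝ (Fin q)) :
    U.activity (x - y) = U.activity x - U.activity y := U.activityCLM.map_sub x y

theorem activity_smul (U : PolyaUrn q) (c : ℝ) (x : EuclideanSpace ℝ (Fin q)) :
    U.activity (c • x) = c * U.activity x := U.activityCLM.map_smul c x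

instance (U : PolyaUrn q) (i : Fin q) : IsProbabilityMeasure (U.ξ i) := U.ξ_prob i

theorem measurable_changeLaw (U : PolyaUrn q) : Measurable U.changeLaw := by
  unfold changeLaw
  refine Measurable.ite (measurableSet_lt measurable_const U.measurable_activity) ?_
    measurable_const
  refine Measure.measurable_of_measurable_coe _ fun s hs => ?_
  simp only [Measure.coe_finsetSum, Finset.sum_apply, Measure.smul_apply, smul_eq_mul]
  have := U.measurable_activity
  fun_prop

theorem isProbabilityMeasure_changeLaw (U : PolyaUrn q) {x : EuclideanSpace ℝ (Fin q)}
    (hx : ∀ i, 0 ≤ x i) : IsProbabilityMeasure (U.changeLaw x) := by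
  unfold changeLaw
  split_ifs with h
  · refine ⟨?_⟩
    simp only [Measure.coe_finsetSum, Finset.sum_apply, Measure.smul_apply, smul_eq_mul,
      measure_univ, mul_one]
    rw [← ENNReal.ofReal_sum_of_nonneg fun i _ =>
      div_nonneg (mul_nonneg (U.a_nonneg i) (hx i)) h.le, ← Finset.sum_div]
    change ENNReal.ofReal (U.activity x / U.activity x) = 1
    rw [div_self h.ne', ENNReal.ofReal_one]
  · infer_instance

open scoped Classical in
/-- The one-step transition kernel for the change of the composition, made Markov by declaring the
change to be `0` from compositions with a negative entry. -/
noncomputable def changeKernel (U : PolyaUrn q) :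
    Kernel (EuclideanSpace ℝ (Fin q)) (EuclideanSpace ℝ (Fin q)) where
  toFun x := if ∀ i, 0 ≤ x i then U.changeLaw x else Measure.dirac 0
  measurable' := Measurable.ite
    (by
      simp only [Set.ofPred_forall]
      exact MeasurableSet.iInter fun i => measurableSet_le measurable_const (by fun_prop))
    U.measurable_changeLaw measurable_const

theorem changeKernel_apply (U : PolyaUrn q) {x : EuclideanSpace ℝ (Fin q)} (hx : ∀ i, 0 ≤ x i) :
    U.changeKernel x = U.changeLaw x := if_pos hx

instance (U : PolyaUrn q) : IsMarkovKernel U.changeKernel := by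
  refine ⟨fun x => ?_⟩
  by_cases hx : ∀ i, 0 ≤ x i
  · rw [U.changeKernel_apply hx]; exact U.isProbabilityMeasure_changeLaw hx
  · rw [show U.changeKernel x = Measure.dirac 0 from if_neg hx]; infer_instance

/-- The σ-algebra generated by `X 0, …, X n`. -/
abbrev past {Ω : Type*} (X : ℕ → Ω → EuclideanSpace ℝ (Fin q)) (n : ℕ) : MeasurableSpace Ω :=
  ⨆ k ∈ Set.Iic n, MeasurableSpace.comap (X k) inferInstance

theorem measurable_past {Ω : Type*} (X : ℕ → Ω → EuclideanSpace ℝ (Fin q)) {k n : ℕ}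
    (h : k ≤ n) : Measurable[past X n] (X k) := by
  rw [measurable_iff_comap_le]
  exact le_iSup₂ (f := fun k (_ : k ∈ Set.Iic n) =>
    MeasurableSpace.comap (X k) inferInstance) k h

theorem past_mono {Ω : Type*} (X : ℕ → Ω → EuclideanSpace ℝ (Fin q)) {k n : ℕ} (h : k ≤ n) :
    past X k ≤ past X n :=
  iSup₂_le fun _ hj => measurable_iff_comap_le.1 (measurable_past X (le_trans hj h))

theorem IsRealization.past_le {U : PolyaUrn q} {Ω : Type*} [mΩ : MeasurableSpace Ω]
    {μ : Measure Ω} {X : ℕ → Ω → EuclideanSpace ℝ (Fin q)} (hX : U.IsRealization μ X) (n : ℕ) :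
    past X n ≤ mΩ :=
  iSup₂_le fun k _ => (hX.measurable k).comap_le

namespace IsRealization

variable {U : PolyaUrn q} {Ω : Type*} [MeasurableSpace Ω] {μ : Measure Ω}
  [IsProbabilityMeasure μ] {X : ℕ → Ω → EuclideanSpace ℝ (Fin q)}

/-- Upgrades the conditional probabilities of sets to a joint law, checked on rectangles. The extra
variable `W` is carried along because the propagated noise depends on the whole past, not on `X n`
alone. -/
theorem map_past_change (hX : U.IsRealization μ X) {n : ℕ} (hpos : ∀ᵐ ω ∂μ, ∀ i, 0 ≤ X n ω i)
    {Z : Type*} [MeasurableSpace Z] {W : Ω → Z} (hW : Measurable[past X n] W) :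
    μ.map (fun ω => ((W ω, X n ω), X (n + 1) ω - X n ω)) =
      (μ.map fun ω => (W ω, X n ω)) ⊗ₘ (U.changeKernel.comap Prod.snd measurable_snd) := by
  have hle := hX.past_le n
  have hW0 : Measurable W := hW.mono hle le_rfl
  have hn := hX.measurable n
  have hn1 := hX.measurable (n + 1)
  have hWX : Measurable[past X n] fun ω => (W ω, X n ω) := hW.prodMk (measurable_past X le_rfl)
  have hWX0 : Measurable fun ω => (W ω, X n ω) := hW0.prodMk hn
  have hmap : IsProbabilityMeasure (μ.map fun ω => (W ω, X n ω)) :=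
    Measure.isProbabilityMeasure_map hWX0.aemeasurable
  have hmap' : IsProbabilityMeasure (μ.map (fun ω => ((W ω, X n ω), X (n + 1) ω - X n ω))) :=
    Measure.isProbabilityMeasure_map (by fun_prop)
  refine Measure.ext_prod fun {s t} hs ht => ?_
  have hD : MeasurableSet {ω | X (n + 1) ω - X n ω ∈ t} := (hn1.sub hn) ht
  have hA : MeasurableSet[past X n] ((fun ω => (W ω, X n ω)) ⁻¹' s) := hWX hs
  set A := (fun ω => (W ω, X n ω)) ⁻¹' s with hAdef
  rw [Measure.map_apply (by fun_prop) (hs.prod ht), Measure.compProd_apply_prod hs ht,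
    setLIntegral_map hs (Kernel.measurable_coe _ ht) hWX0]
  have hc : μ[{ω | X (n + 1) ω - X n ω ∈ t}.indicator (1 : Ω → ℝ) | past X n] =ᵐ[μ]
      fun ω => (U.changeLaw (X n ω)).real t := hX.step n t ht
  have h1 := setIntegral_condExp (μ := μ) hle
    (f := {ω | X (n + 1) ω - X n ω ∈ t}.indicator 1)
    ((integrable_const (1 : ℝ)).indicator hD) hA
  rw [setIntegral_congr_ae (g := fun ω => (U.changeLaw (X n ω)).real t) (hle _ hA)
    (hc.mono fun ω h _ => h), integral_indicator_one hD,
    measureReal_restrict_apply hD] at h1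
  have h2 : ∫ ω in A, (U.changeLaw (X n ω)).real t ∂μ =
      ∫ ω in A, (U.changeKernel (X n ω)).real t ∂μ :=
    setIntegral_congr_ae (hle _ hA) (hpos.mono fun ω h _ => by rw [U.changeKernel_apply h])
  have hmeas : Measurable fun ω => U.changeKernel (X n ω) t :=
    (Kernel.measurable_coe _ ht).comp hn
  have h3 : ENNReal.ofReal (∫ ω in A, (U.changeKernel (X n ω)).real t ∂μ) =
      ∫⁻ ω in A, U.changeKernel (X n ω) t ∂μ := by
    rw [ofReal_integral_eq_lintegral_ofReal]
    · simp
    · exact Integrable.of_bound (hmeas.ennreal_toReal.aestronglyMeasurable) 1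
        (ae_of_all _ fun ω => by
          rw [Real.norm_of_nonneg measureReal_nonneg]; exact measureReal_le_one)
    · exact ae_of_all _ fun ω => measureReal_nonneg
  change μ _ = ∫⁻ ω in A, U.changeKernel (X n ω) t ∂μ
  rw [← h3, ← h2, h1, ofReal_measureReal, Set.inter_comm]
  rfl

/-- Integrals of functions of the past and of the next change, computed by integrating out the
change. -/
theorem lintegral_past_change (hX : U.IsRealization μ X) {n : ℕ}
    (hpos : ∀ᵐ ω ∂μ, ∀ i, 0 ≤ X n ω i) {Z : Type*} [MeasurableSpace Z] {W : Ω → Z}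
    (hW : Measurable[past X n] W)
    {f : (Z × EuclideanSpace ℝ (Fin q)) × EuclideanSpace ℝ (Fin q) → ENNReal}
    (hf : Measurable f) :
    ∫⁻ ω, f ((W ω, X n ω), X (n + 1) ω - X n ω) ∂μ =
      ∫⁻ ω, ∫⁻ y, f ((W ω, X n ω), y) ∂(U.changeKernel (X n ω)) ∂μ := by
  have hW0 : Measurable W := hW.mono (hX.past_le n) le_rfl
  have hn := hX.measurable n
  have hn1 := hX.measurable (n + 1)
  have hWX0 : Measurable fun ω => (W ω, X n ω) := hW0.prodMk hn
  have hmap : IsProbabilityMeasure (μ.map fun ω => (W ω, X n ω)) :=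
    Measure.isProbabilityMeasure_map hWX0.aemeasurable
  rw [← lintegral_map (μ := μ) (g := fun ω => ((W ω, X n ω), X (n + 1) ω - X n ω)) hf
    (by fun_prop), hX.map_past_change hpos hW, Measure.lintegral_compProd hf,
    lintegral_map (Measurable.lintegral_kernel_prod_right' hf) hWX0]
  rfl

theorem lintegral_change (hX : U.IsRealization μ X) {n : ℕ}
    (hpos : ∀ᵐ ω ∂μ, ∀ i, 0 ≤ X n ω i)
    {f : EuclideanSpace ℝ (Fin q) × EuclideanSpace ℝ (Fin q) → ENNReal} (hf : Measurable f) :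
    ∫⁻ ω, f (X n ω, X (n + 1) ω - X n ω) ∂μ =
      ∫⁻ ω, ∫⁻ y, f (X n ω, y) ∂(U.changeKernel (X n ω)) ∂μ :=
  hX.lintegral_past_change hpos (W := fun _ => ()) measurable_const
    (f := fun z => f (z.1.2, z.2)) (by fun_prop)

/-- Both claims need a joint induction: tenability concerns `stateLaw`, so the law at time `n` gives
nonnegativity there, and nonnegativity is what identifies `changeKernel` with `changeLaw` in the
next step. -/
theorem map_eq_stateLaw_and_nonneg (hX : U.IsRealization μ X) (hT : U.Tenable) (n : ℕ) :
    μ.map (X n) = U.stateLaw n ∧ ∀ᵐ ω ∂μ, ∀ i, 0 ≤ X n ω i := by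
  have hpos : ∀ n, μ.map (X n) = U.stateLaw n → ∀ᵐ ω ∂μ, ∀ i, 0 ≤ X n ω i := fun n h =>
    ae_of_ae_map (hX.measurable n).aemeasurable (h ▸ hT n)
  induction n with
  | zero =>
    have h : μ.map (X 0) = U.stateLaw 0 := by
      rw [Measure.map_congr hX.init, Measure.map_const, measure_univ, one_smul]; rfl
    exact ⟨h, hpos 0 h⟩
  | succ n ih =>
    have h : μ.map (X (n + 1)) = U.stateLaw (n + 1) := by
      have hm : Measurable fun x => (U.changeLaw x).map fun y => x + y := by
        refine Measure.measurable_of_measurable_coe _ fun s hs => ?_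
        have e : ∀ x, ((U.changeLaw x).map fun y => x + y) s =
            U.changeLaw x ((fun y => x + y) ⁻¹' s) := fun x =>
          Measure.map_apply (by fun_prop) hs
        simp_rw [e]
        unfold changeLaw
        have e2 : ∀ x, (if 0 < U.activity x then
            ∑ i, ENNReal.ofReal (U.a i * x i / U.activity x) • U.ξ i
            else Measure.dirac 0) ((fun y => x + y) ⁻¹' s) = if 0 < U.activity x then
            ∑ i, ENNReal.ofReal (U.a i * x i / U.activity x) * U.ξ i ((fun y => x + y) ⁻¹' s)
            else s.indicator 1 x := fun x => by
          split_ifs with h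
          · simp
          · rw [Measure.dirac_apply' _ (measurable_const_add x hs)]
            by_cases hx : x ∈ s <;> simp [hx]
        simp_rw [e2]
        have h1 := U.measurable_activity
        have h2 : ∀ i, Measurable fun x => U.ξ i ((fun y => x + y) ⁻¹' s) := fun i =>
          measurable_measure_prodMk_left (ν := U.ξ i)
            (s := (fun z : EuclideanSpace ℝ (Fin q) × EuclideanSpace ℝ (Fin q) => z.1 + z.2) ⁻¹' s)
            (measurable_add hs)
        refine Measurable.ite (measurableSet_lt measurable_const h1) ?_
          (measurable_one.indicator hs)
        fun_prop
      ext s hs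
      rw [stateLaw, Measure.bind_apply hs hm.aemeasurable, ← ih.1, lintegral_map (f := fun x =>
          ((U.changeLaw x).map fun y => x + y) s)
        ((Measure.measurable_coe hs).comp hm) (hX.measurable n),
        Measure.map_apply (hX.measurable _) hs, ← lintegral_indicator_one (hX.measurable _ hs)]
      have := hX.lintegral_change ih.2 (f := fun z => s.indicator 1 (z.1 + z.2))
        ((measurable_one.indicator hs).comp (by fun_prop))
      simp only [add_sub_cancel] at this
      refine Eq.trans ?_ (this.trans (lintegral_congr_ae (ih.2.mono fun ω hω => ?_)))
      · rfl
      · simp only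
        rw [U.changeKernel_apply hω, Measure.map_apply (by fun_prop) hs,
          ← lintegral_indicator_one (by exact measurable_const_add _ hs)]
        rfl
    exact ⟨h, hpos _ h⟩

theorem ae_nonneg (hX : U.IsRealization μ X) (hT : U.Tenable) (n : ℕ) :
    ∀ᵐ ω ∂μ, ∀ i, 0 ≤ X n ω i :=
  (hX.map_eq_stateLaw_and_nonneg hT n).2

end IsRealization

end PolyaUrn

/-! ### Drift and centred noise. -/

namespace PolyaUrn

variable {q : ℕ}

/-- The mean replacement vector for colour `j`. -/
noncomputable def meanVec (U : PolyaUrn q) (j : Fin q) : EuclideanSpace ℝ (Fin q) :=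
  ∫ y, y ∂(U.ξ j)

/-- The intensity matrix as an operator on real vectors. -/
noncomputable def driftMap (U : PolyaUrn q) :
    EuclideanSpace ℝ (Fin q) →L[ℝ] EuclideanSpace ℝ (Fin q) :=
  ∑ j, (U.a j • EuclideanSpace.proj j : EuclideanSpace ℝ (Fin q) →L[ℝ] ℝ).smulRight (U.meanVec j)

theorem driftMap_apply (U : PolyaUrn q) (x : EuclideanSpace ℝ (Fin q)) :
    U.driftMap x = ∑ j, (U.a j * x j) • U.meanVec j := by
  simp [driftMap]

/-- The sum of the norms of the mean replacement vectors. -/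
noncomputable def meanBound (U : PolyaUrn q) : ℝ := ∑ j, ‖U.meanVec j‖

theorem meanBound_nonneg (U : PolyaUrn q) : 0 ≤ U.meanBound :=
  Finset.sum_nonneg fun _ _ => norm_nonneg _

/-- For nonnegative entries the drift is a combination of the mean vectors with nonnegative weights
of sum `a·x`. This proportionality to the activity later cancels the factor `1 / S_n`. -/
theorem norm_driftMap_le (U : PolyaUrn q) {x : EuclideanSpace ℝ (Fin q)} (hx : ∀ i, 0 ≤ x i) :
    ‖U.driftMap x‖ ≤ U.activity x * U.meanBound := by
  have h0 : ∀ j, 0 ≤ U.a j * x j := fun j => mul_nonneg (U.a_nonneg j) (hx j)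
  rw [driftMap_apply, activity, Finset.sum_mul]
  refine (norm_sum_le _ _).trans (Finset.sum_le_sum fun j _ => ?_)
  rw [norm_smul, Real.norm_of_nonneg (h0 j)]
  exact mul_le_mul_of_nonneg_left (Finset.single_le_sum (f := fun j => ‖U.meanVec j‖)
    (fun _ _ => norm_nonneg _) (Finset.mem_univ j)) (h0 j)

/-- The centred change of the composition. -/
noncomputable def noise (U : PolyaUrn q) (x y : EuclideanSpace ℝ (Fin q)) :
    EuclideanSpace ℝ (Fin q) :=
  if 0 < U.activity x then y - (U.activity x)⁻¹ • U.driftMap x else 0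

theorem measurable_noise (U : PolyaUrn q) :
    Measurable fun z : EuclideanSpace ℝ (Fin q) × EuclideanSpace ℝ (Fin q) =>
      U.noise z.1 z.2 := by
  have := U.measurable_activity
  refine Measurable.ite (measurableSet_lt measurable_const (by fun_prop)) ?_ measurable_const
  fun_prop

/-- The sum of the `L^p` norms of the replacement vectors. -/
noncomputable def momentBound (U : PolyaUrn q) (p : ℝ) : ℝ :=
  ∑ i, (eLpNorm (fun y => y) (ENNReal.ofReal p) (U.ξ i)).toReal

theorem momentBound_nonneg (U : PolyaUrn q) (p : ℝ) : 0 ≤ U.momentBound p :=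
  Finset.sum_nonneg fun _ _ => ENNReal.toReal_nonneg

theorem changeLaw_eq_sum (U : PolyaUrn q) {x : EuclideanSpace ℝ (Fin q)}
    (hS : 0 < U.activity x) : U.changeLaw x =
      ∑ i, ENNReal.ofReal (U.a i * x i / U.activity x) • U.ξ i := if_pos hS

theorem integral_changeLaw (U : PolyaUrn q) {x : EuclideanSpace ℝ (Fin q)} (hx : ∀ i, 0 ≤ x i)
    (hS : 0 < U.activity x) {F : Type*} [NormedAddCommGroup F] [NormedSpace ℝ F]
    {f : EuclideanSpace ℝ (Fin q) → F} (hf : ∀ i, Integrable f (U.ξ i)) :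
    Integrable f (U.changeLaw x) ∧
    ∫ y, f y ∂(U.changeLaw x) = ∑ i, (U.a i * x i / U.activity x) • ∫ y, f y ∂(U.ξ i) := by
  have hi : ∀ i ∈ Finset.univ,
      Integrable f (ENNReal.ofReal (U.a i * x i / U.activity x) • U.ξ i) :=
    fun i _ => (hf i).smul_measure ENNReal.ofReal_ne_top
  rw [U.changeLaw_eq_sum hS]
  refine ⟨integrable_finsetSum_measure.2 hi, ?_⟩
  rw [integral_finsetSum_measure hi]
  refine Finset.sum_congr rfl fun i _ => ?_
  rw [integral_smul_measure, ENNReal.toReal_ofReal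
    (div_nonneg (mul_nonneg (U.a_nonneg i) (hx i)) hS.le)]

theorem lintegral_changeLaw_le (U : PolyaUrn q) {x : EuclideanSpace ℝ (Fin q)}
    (hx : ∀ i, 0 ≤ x i) (hS : 0 < U.activity x) {f : EuclideanSpace ℝ (Fin q) → ENNReal}
    {c : ENNReal} (hf : ∀ i, ∫⁻ y, f y ∂(U.ξ i) ≤ c) : ∫⁻ y, f y ∂(U.changeLaw x) ≤ c := by
  have h1 := (U.isProbabilityMeasure_changeLaw hx).measure_univ
  rw [U.changeLaw_eq_sum hS] at h1 ⊢
  simp only [Measure.coe_finsetSum, Finset.sum_apply, Measure.smul_apply, smul_eq_mul,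
    measure_univ, mul_one] at h1
  rw [lintegral_finsetSum_measure]
  calc _ ≤ ∑ i, ENNReal.ofReal (U.a i * x i / U.activity x) * c := by
        refine Finset.sum_le_sum fun i _ => ?_
        rw [lintegral_smul_measure, smul_eq_mul]
        exact mul_le_mul_right (hf i) _
    _ = c := by rw [← Finset.sum_mul, h1, one_mul]

namespace Cond

variable {U : PolyaUrn q} {b p : ℝ}

theorem integrable_id (hU : U.Cond b p) (hp : 2 ≤ p) (i : Fin q) :
    Integrable (fun y => y) (U.ξ i) :=
  (hU.moment i).integrable (by
    rw [← ENNReal.ofReal_one]; exact ENNReal.ofReal_le_ofReal (by linarith))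

theorem memLp_two (hU : U.Cond b p) (hp : 2 ≤ p) (i : Fin q) :
    MemLp (fun y => y) 2 (U.ξ i) :=
  (hU.moment i).mono_exponent (by
    rw [← ENNReal.ofReal_ofNat]; exact ENNReal.ofReal_le_ofReal hp)

theorem meanVec_apply (hU : U.Cond b p) (hp : 2 ≤ p) (i j : Fin q) :
    U.meanVec j i = ∫ y, y i ∂(U.ξ j) :=
  ((EuclideanSpace.proj i : EuclideanSpace ℝ (Fin q) →L[ℝ] ℝ).integral_comp_comm
    (hU.integrable_id hp j)).symm

/-- Balance makes `a` a left eigenvector of the intensity matrix; colours with zero activity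
contribute nothing to either side. -/
theorem activity_driftMap (hU : U.Cond b p) (hp : 2 ≤ p) (x : EuclideanSpace ℝ (Fin q)) :
    U.activity (U.driftMap x) = b * U.activity x := by
  rw [driftMap_apply, ← activityCLM_apply, map_sum, activity, Finset.mul_sum]
  refine Finset.sum_congr rfl fun j _ => ?_
  rw [map_smul, activityCLM_apply, smul_eq_mul]
  rcases (U.a_nonneg j).eq_or_lt with h | h
  · simp [← h]
  · have : U.activity (U.meanVec j) = b := by
      rw [← hU.balanced.2 j h, activity]
      exact Finset.sum_congr rfl fun i _ => by rw [hU.meanVec_apply hp]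
    rw [this]; ring

theorem integral_id_changeLaw (hU : U.Cond b p) (hp : 2 ≤ p) {x : EuclideanSpace ℝ (Fin q)}
    (hx : ∀ i, 0 ≤ x i) (hS : 0 < U.activity x) :
    ∫ y, y ∂(U.changeLaw x) = (U.activity x)⁻¹ • U.driftMap x := by
  rw [(U.integral_changeLaw hx hS (hU.integrable_id hp)).2, driftMap_apply, Finset.smul_sum]
  refine Finset.sum_congr rfl fun i _ => ?_
  rw [smul_smul, div_eq_inv_mul]; rfl

theorem eLpNorm_id_changeLaw_le (hU : U.Cond b p) (hp : 2 ≤ p) {x : EuclideanSpace ℝ (Fin q)}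
    (hx : ∀ i, 0 ≤ x i) (hS : 0 < U.activity x) :
    eLpNorm (fun y => y) (ENNReal.ofReal p) (U.changeLaw x) ≤
      ENNReal.ofReal (U.momentBound p) := by
  have hp0 : 0 < p := by linarith
  rw [eLpNorm_ofReal_le_iff hp0 (U.momentBound_nonneg p)]
  refine U.lintegral_changeLaw_le hx hS fun i => ?_
  rw [← eLpNorm_ofReal_le_iff hp0 (U.momentBound_nonneg p)]
  refine (ENNReal.le_ofReal_iff_toReal_le (hU.moment i).2.ne (U.momentBound_nonneg p)).2 ?_
  exact Finset.single_le_sum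
    (f := fun i => (eLpNorm (fun y => y) (ENNReal.ofReal p) (U.ξ i)).toReal)
    (fun _ _ => ENNReal.toReal_nonneg) (Finset.mem_univ i)

/-- The bound is uniform in the state because the change is drawn from a mixture of the `ξ i` and
the normalised drift is at most `meanBound`. After extinction the noise vanishes, so it is centred
in every nonnegative state. -/
theorem noise_spec (hU : U.Cond b p) (hp : 2 ≤ p) {x : EuclideanSpace ℝ (Fin q)}
    (hx : ∀ i, 0 ≤ x i) :
    MemLp (U.noise x) (ENNReal.ofReal p) (U.changeKernel x) ∧
    ∫ y, U.noise x y ∂(U.changeKernel x) = 0 ∧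
    eLpNorm (U.noise x) (ENNReal.ofReal p) (U.changeKernel x) ≤
      ENNReal.ofReal (U.momentBound p + U.meanBound) := by
  have hprob := U.isProbabilityMeasure_changeLaw hx
  rw [U.changeKernel_apply hx]
  by_cases hS : 0 < U.activity x
  · have e : U.noise x = fun y => y - (U.activity x)⁻¹ • U.driftMap x := by
      ext1 y; exact if_pos hS
    have h1 := hU.eLpNorm_id_changeLaw_le hp hx hS
    have hm : MemLp (fun y => y) (ENNReal.ofReal p) (U.changeLaw x) :=
      ⟨aestronglyMeasurable_id, h1.trans_lt ENNReal.ofReal_lt_top⟩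
    have hpp : 1 ≤ ENNReal.ofReal p := by
      rw [← ENNReal.ofReal_one]; exact ENNReal.ofReal_le_ofReal (by linarith)
    rw [e]
    refine ⟨hm.sub (memLp_const _), ?_, ?_⟩
    · rw [integral_sub (hm.integrable hpp) (integrable_const _), hU.integral_id_changeLaw hp hx hS]
      simp
    · refine (eLpNorm_sub_le hm.1 aestronglyMeasurable_const hpp).trans ?_
      rw [ENNReal.ofReal_add (U.momentBound_nonneg p) U.meanBound_nonneg]
      refine add_le_add h1 ?_
      rw [eLpNorm_const _ (by simpa using (by linarith : 0 < p)) (NeZero.ne _), measure_univ,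
        ENNReal.one_rpow, mul_one, ← ofReal_norm]
      refine ENNReal.ofReal_le_ofReal ?_
      rw [norm_smul, norm_inv, Real.norm_of_nonneg hS.le, inv_mul_le_iff₀ hS]
      exact U.norm_driftMap_le hx
  · have e : U.noise x = fun y => 0 := by
      ext1 y; exact if_neg hS
    rw [e]
    simp

theorem integrable_activity_sq (hU : U.Cond b p) (hp : 2 ≤ p) (i : Fin q) :
    Integrable (fun y => U.activity y ^ 2) (U.ξ i) :=
  ((U.activityCLM.comp_memLp' (hU.memLp_two hp i)).integrable_sq :)

end Cond

/-! ### A supermartingale bounding the extinction probability. -/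

/-- The constant in the bound for the extinction probability. -/
noncomputable def survConst (U : PolyaUrn q) (b : ℝ) : ℝ :=
  (∑ i, ∫ y, U.activity y ^ 2 ∂(U.ξ i)) / b + 1

theorem survConst_pos (U : PolyaUrn q) {b : ℝ} (hb : 0 < b) : 0 < U.survConst b := by
  have : 0 ≤ ∑ i, ∫ y, U.activity y ^ 2 ∂(U.ξ i) :=
    Finset.sum_nonneg fun i _ => integral_nonneg fun y => sq_nonneg _
  unfold survConst
  positivity

/-- Exact second-order expansion of `K / (t + K)` at `s`. Truncation at `0` only helps: it increases
the linear term and, as `s ≥ 0`, does not increase the square. It is needed because a single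
increment may take the activity below `0`. -/
theorem inv_max_add_le {s d K : ℝ} (hs : 0 ≤ s) (hK : 0 < K) :
    K / (max (s + d) 0 + K) ≤ K / (s + K) - K / (s + K) ^ 2 * (d - d ^ 2 / K) := by
  set t := max (s + d) 0 with ht
  have ht0 : 0 ≤ t := le_max_right _ _
  have htd : s + d ≤ t := le_max_left _ _
  have hsq : (t - s) ^ 2 ≤ d ^ 2 := by
    rcases le_total (s + d) 0 with h | h
    · rw [ht, max_eq_right h]; nlinarith
    · rw [ht, max_eq_left h]; nlinarith
  have hsK : 0 < s + K := by linarith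
  have htK : 0 < t + K := by linarith
  have h1 : K / (t + K) = K / (s + K) - K / (s + K) ^ 2 * ((t - s) - (t - s) ^ 2 / (t + K)) := by
    field_simp; ring
  rw [h1]
  have h2 : (t - s) ^ 2 / (t + K) ≤ d ^ 2 / K :=
    div_le_div₀ (sq_nonneg _) hsq hK (by linarith)
  have h3 : 0 ≤ K / (s + K) ^ 2 := by positivity
  have := mul_le_mul_of_nonneg_left (show d - d ^ 2 / K ≤ (t - s) - (t - s) ^ 2 / (t + K) by
    linarith) h3
  linarith

/-- The mean activity increment is `b` and its second moment is at most `b K`, so the first-order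
gain outweighs the second-order loss. -/
theorem Cond.lintegral_surv_le {U : PolyaUrn q} {b p : ℝ} (hU : U.Cond b p) (hp : 2 ≤ p)
    {x : EuclideanSpace ℝ (Fin q)} (hx : ∀ i, 0 ≤ x i) :
    ∫⁻ y, ENNReal.ofReal (U.survConst b / (max (U.activity (x + y)) 0 + U.survConst b))
      ∂(U.changeKernel x) ≤
      ENNReal.ofReal (U.survConst b / (max (U.activity x) 0 + U.survConst b)) := by
  have hb := hU.balanced.1
  have hK := U.survConst_pos hb
  set K := U.survConst b with hKdef
  have hprob := U.isProbabilityMeasure_changeLaw hx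
  rw [U.changeKernel_apply hx]
  by_cases hS : 0 < U.activity x
  · set s := U.activity x with hs
    rw [max_eq_left hS.le]
    have hi1 : Integrable U.activity (U.changeLaw x) := (U.integral_changeLaw hx hS fun i =>
      U.activityCLM.integrable_comp (hU.integrable_id hp i)).1
    have hi2 := U.integral_changeLaw hx hS fun i => hU.integrable_activity_sq hp i
    have e1 : ∫ y, U.activity y ∂(U.changeLaw x) = b := by
      have := U.activityCLM.integral_comp_comm
        (U.integral_changeLaw hx hS (hU.integrable_id hp)).1
      rw [hU.integral_id_changeLaw hp hx hS] at this
      simp only [activityCLM_apply, activity_smul, hU.activity_driftMap hp] at this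
      rw [this, ← hs]; field_simp
    have e2 : ∫ y, U.activity y ^ 2 ∂(U.changeLaw x) ≤ b * K := by
      have : b * K = ∑ i, ∫ y, U.activity y ^ 2 ∂(U.ξ i) + b := by
        rw [hKdef, survConst]; field_simp
      rw [this, hi2.2]
      refine le_add_of_le_of_nonneg (Finset.sum_le_sum fun i _ => ?_) hb.le
      refine mul_le_of_le_one_left (integral_nonneg fun y => sq_nonneg _) ((div_le_one hS).2 ?_)
      exact Finset.single_le_sum (f := fun i => U.a i * x i)
        (fun i _ => mul_nonneg (U.a_nonneg i) (hx i)) (Finset.mem_univ i)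
    have hd : Integrable (fun y => U.activity y - U.activity y ^ 2 / K) (U.changeLaw x) :=
      hi1.sub (hi2.1.div_const K)
    have hg : Integrable (fun y => K / (s + K) - K / (s + K) ^ 2 *
        (U.activity y - U.activity y ^ 2 / K)) (U.changeLaw x) :=
      (integrable_const _).sub (hd.const_mul _)
    refine (lintegral_mono fun y => ENNReal.ofReal_le_ofReal ?_).trans
      ((ofReal_integral_eq_lintegral_ofReal hg (ae_of_all _ fun y => ?_)).symm.trans_le ?_)
    · rw [activity_add]; exact inv_max_add_le hS.le hK
    · exact le_trans (by positivity) (inv_max_add_le (d := U.activity y) hS.le hK)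
    · refine ENNReal.ofReal_le_ofReal ?_
      rw [integral_sub (integrable_const _) (hd.const_mul _), integral_const_mul,
        integral_sub hi1 (hi2.1.div_const K), e1,
        show ∫ y, U.activity y ^ 2 / K ∂(U.changeLaw x) =
          (∫ y, U.activity y ^ 2 ∂(U.changeLaw x)) / K from integral_div K _]
      simp only [integral_const, probReal_univ, one_smul]
      have h3 : (∫ y, U.activity y ^ 2 ∂(U.changeLaw x)) / K ≤ b := (div_le_iff₀ hK).2 e2
      have : 0 ≤ K / (s + K) ^ 2 := by positivity
      nlinarith
  · have : U.changeLaw x = Measure.dirac 0 := if_neg hS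
    rw [this, lintegral_dirac, add_zero]

theorem measurableSet_nonExtinct (U : PolyaUrn q) {Ω : Type*}
    (X : ℕ → Ω → EuclideanSpace ℝ (Fin q)) {k n : ℕ} (h : k ≤ n) :
    MeasurableSet[past X n] (U.nonExtinct X k) := by
  have : U.nonExtinct X k = ⋂ j, ⋂ (_ : j ≤ k), {ω | 0 < U.activity (X j ω)} := by
    ext ω; simp [nonExtinct]
  rw [this]
  refine MeasurableSet.iInter fun j => MeasurableSet.iInter fun hj => ?_
  exact (U.measurable_activity.comp (measurable_past X (hj.trans h))) measurableSet_Ioi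

namespace IsRealization

variable {U : PolyaUrn q} {Ω : Type*} [MeasurableSpace Ω] {μ : Measure Ω}
  [IsProbabilityMeasure μ] {X : ℕ → Ω → EuclideanSpace ℝ (Fin q)} {b p : ℝ}

theorem integrable (hX : U.IsRealization μ X) (hU : U.Cond b p) (hp : 2 ≤ p) (n : ℕ) :
    Integrable (X n) μ := by
  induction n with
  | zero => exact (integrable_const U.x₀).congr (hX.init.mono fun ω h => h.symm)
  | succ n ih =>
    have hpos := hX.ae_nonneg hU.tenable n
    have hd : Integrable (fun ω => X (n + 1) ω - X n ω) μ := by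
      refine ⟨((hX.measurable _).sub (hX.measurable _)).aestronglyMeasurable, ?_⟩
      rw [hasFiniteIntegral_iff_enorm]
      have := hX.lintegral_change hpos (f := fun z => ‖z.2‖ₑ) (by fun_prop)
      simp only at this
      rw [this]
      refine (lintegral_mono_ae (g := fun _ => ∑ i, ∫⁻ y, ‖y‖ₑ ∂(U.ξ i))
        (hpos.mono fun ω hω => ?_)).trans_lt ?_
      · rw [U.changeKernel_apply hω]
        by_cases hS : 0 < U.activity (X n ω)
        · exact U.lintegral_changeLaw_le hω hS fun i =>
            Finset.single_le_sum (f := fun i => ∫⁻ y, ‖y‖ₑ ∂(U.ξ i)) (fun _ _ => zero_le)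
              (Finset.mem_univ i)
        · rw [show U.changeLaw (X n ω) = Measure.dirac 0 from if_neg hS]; simp
      · rw [lintegral_const, measure_univ, mul_one]
        exact ENNReal.sum_lt_top.2 fun i _ => (hU.integrable_id hp i).2
    exact (ih.add hd).congr (ae_of_all _ fun ω => by simp)

theorem ae_absorbed (hX : U.IsRealization μ X) (hT : U.Tenable) (n : ℕ) :
    ∀ᵐ ω ∂μ, ¬ 0 < U.activity (X n ω) → X (n + 1) ω = X n ω := by
  have hpos := hX.ae_nonneg hT n
  set s : Set (EuclideanSpace ℝ (Fin q) × EuclideanSpace ℝ (Fin q)) :=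
    {z | ¬ 0 < U.activity z.1 ∧ z.2 ≠ 0} with hs
  have hsm : MeasurableSet s :=
    (measurableSet_lt measurable_const (U.measurable_activity.comp measurable_fst)).compl.inter
      (measurable_snd (measurableSet_singleton 0).compl)
  have h := hX.lintegral_change hpos (f := s.indicator 1) (measurable_one.indicator hsm)
  have h0 : ∫⁻ ω, ∫⁻ y, s.indicator 1 (X n ω, y) ∂(U.changeKernel (X n ω)) ∂μ = 0 := by
    rw [← lintegral_zero (μ := μ)]
    refine lintegral_congr_ae (hpos.mono fun ω hω => ?_)
    simp only
    rw [U.changeKernel_apply hω]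
    by_cases hS : 0 < U.activity (X n ω)
    · simp [hs, Set.indicator, hS.not_ge]
    · rw [show U.changeLaw (X n ω) = Measure.dirac 0 from if_neg hS, lintegral_dirac]
      simp [hs]
  have hm : Measurable fun ω => s.indicator
      (1 : EuclideanSpace ℝ (Fin q) × EuclideanSpace ℝ (Fin q) → ENNReal) (X n ω, X (n + 1) ω - X n ω) :=
    (measurable_one.indicator hsm).comp
      ((hX.measurable n).prodMk ((hX.measurable (n + 1)).sub (hX.measurable n)))
  rw [h0, lintegral_eq_zero_iff hm] at h
  filter_upwards [h] with ω hω hS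
  by_contra hne
  have : (X n ω, X (n + 1) ω - X n ω) ∈ s := ⟨hS, sub_ne_zero.2 hne⟩
  simp [this] at hω

/-- A state without positive activity is frozen, so positive activity at time `n` forces it at all
earlier times. -/
theorem ae_mem_nonExtinct (hX : U.IsRealization μ X) (hT : U.Tenable) (n : ℕ) :
    ∀ᵐ ω ∂μ, 0 < U.activity (X n ω) → ω ∈ U.nonExtinct X n := by
  filter_upwards [ae_all_iff.2 (hX.ae_absorbed hT)] with ω hω hn k hk
  by_contra hS
  have : ∀ j, X (k + j) ω = X k ω := fun j => by
    induction j with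
    | zero => rfl
    | succ j ih => rw [← add_assoc, hω (k + j) (by rwa [ih]), ih]
  obtain ⟨j, rfl⟩ := Nat.exists_eq_add_of_le hk
  rw [this] at hn
  exact hS hn

theorem survival (hX : U.IsRealization μ X) (hU : U.Cond b p) (hp : 2 ≤ p) (n : ℕ) :
    U.activity U.x₀ / (U.activity U.x₀ + U.survConst b) ≤ μ.real (U.nonExtinct X n) := by
  have hK := U.survConst_pos hU.balanced.1
  have hS0 : 0 < U.activity U.x₀ := U.x₀_active
  set K := U.survConst b with hKdef
  have hA := U.measurable_activity
  have hsup : ∀ n, ∫⁻ ω, ENNReal.ofReal (K / (max (U.activity (X n ω)) 0 + K)) ∂μ ≤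
      ENNReal.ofReal (K / (U.activity U.x₀ + K)) := fun n => by
    induction n with
    | zero =>
      rw [lintegral_congr_ae (g := fun _ => ENNReal.ofReal (K / (U.activity U.x₀ + K)))
        (hX.init.mono fun ω h => by simp only [h, max_eq_left hS0.le])]
      simp
    | succ n ih =>
      have hpos := hX.ae_nonneg hU.tenable n
      have := hX.lintegral_change hpos
        (f := fun z => ENNReal.ofReal (K / (max (U.activity (z.1 + z.2)) 0 + K))) (by fun_prop)
      simp only [add_sub_cancel] at this
      rw [this]
      exact (lintegral_mono_ae (hpos.mono fun ω hω => hU.lintegral_surv_le hp hω)).trans ih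
  have hm : MeasurableSet (U.nonExtinct X n) :=
    hX.past_le n _ (U.measurableSet_nonExtinct X le_rfl)
  have h1 : μ (U.nonExtinct X n)ᶜ ≤ ENNReal.ofReal (K / (U.activity U.x₀ + K)) := by
    refine le_trans ?_ (hsup n)
    rw [← lintegral_indicator_one hm.compl]
    -- On extinction the activity is at most `0` and the supermartingale equals `1`, which gives the
    -- Markov-type bound.
    refine lintegral_mono_ae ((hX.ae_mem_nonExtinct hU.tenable n).mono fun ω hω => ?_)
    by_cases hmem : ω ∈ (U.nonExtinct X n)ᶜ
    · have : U.activity (X n ω) ≤ 0 := not_lt.1 fun h => hmem (hω h)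
      simp [hmem, max_eq_right this, hK.ne']
    · simp [Set.indicator_of_notMem hmem]
  have h2 : μ.real (U.nonExtinct X n)ᶜ ≤ K / (U.activity U.x₀ + K) :=
    ENNReal.toReal_le_of_le_ofReal (by positivity) h1
  rw [probReal_compl_eq_one_sub hm] at h2
  have : U.activity U.x₀ / (U.activity U.x₀ + K) = 1 - K / (U.activity U.x₀ + K) := by
    field_simp; ring
  linarith

end IsRealization

end PolyaUrn

/-! ### Linearised evolution: deterministic path, propagated noise, propagated errors. -/

namespace PolyaUrn

variable {q : ℕ}

/-- The bound for the growth of second-order terms caused by one step of noise. -/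
noncomputable def noiseConst (U : PolyaUrn q) (p : ℝ) : ℝ :=
  2 * smoothConst p * (U.momentBound p + U.meanBound) ^ 2 + 1

theorem noiseConst_pos (U : PolyaUrn q) {p : ℝ} (hp : 2 ≤ p) : 0 < U.noiseConst p := by
  have := smoothConst_pos hp
  unfold noiseConst; positivity

/-- The deterministic approximation `a · x₀ + b k` of the total activity at time `k`. -/
noncomputable def scale (U : PolyaUrn q) (b : ℝ) (k : ℕ) : ℝ := U.activity U.x₀ + b * k

theorem scale_pos (U : PolyaUrn q) {b : ℝ} (hb : 0 < b) (k : ℕ) : 0 < U.scale b k := by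
  have : 0 < U.activity U.x₀ := U.x₀_active
  unfold scale; positivity

/-- The linear map describing one step of the mean evolution. -/
noncomputable def stepMap (U : PolyaUrn q) (b : ℝ) (k : ℕ) :
    EuclideanSpace ℝ (Fin q) →L[ℝ] EuclideanSpace ℝ (Fin q) :=
  ContinuousLinearMap.id ℝ _ + (U.scale b k)⁻¹ • U.driftMap

theorem stepMap_apply (U : PolyaUrn q) (b : ℝ) (k : ℕ) (x : EuclideanSpace ℝ (Fin q)) :
    U.stepMap b k x = x + (U.scale b k)⁻¹ • U.driftMap x := rfl

/-- The deterministic mean evolution started from `x₀`. -/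
noncomputable def meanPath (U : PolyaUrn q) (b : ℝ) : ℕ → EuclideanSpace ℝ (Fin q)
  | 0 => U.x₀
  | n + 1 => U.stepMap b n (U.meanPath b n)

variable {Ω : Type*}

/-- The sum of the noise terms before time `n`. -/
noncomputable def noiseSum (U : PolyaUrn q) (X : ℕ → Ω → EuclideanSpace ℝ (Fin q)) :
    ℕ → Ω → EuclideanSpace ℝ (Fin q)
  | 0, _ => 0
  | n + 1, ω => U.noiseSum X n ω + U.noise (X n ω) (X (n + 1) ω - X n ω)

/-- The noise propagated by the mean evolution. -/
noncomputable def martPart (U : PolyaUrn q) (b : ℝ) (X : ℕ → Ω → EuclideanSpace ℝ (Fin q)) :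
    ℕ → Ω → EuclideanSpace ℝ (Fin q)
  | 0, _ => 0
  | n + 1, ω => U.stepMap b n (U.martPart b X n ω) + U.noise (X n ω) (X (n + 1) ω - X n ω)

/-- The error made in one step by replacing the total activity with its approximation. -/
noncomputable def stepErr (U : PolyaUrn q) (b : ℝ) (X : ℕ → Ω → EuclideanSpace ℝ (Fin q))
    (n : ℕ) : Ω → EuclideanSpace ℝ (Fin q) :=
  (U.nonExtinct X n).indicator fun ω =>
    ((U.activity (X n ω))⁻¹ - (U.scale b n)⁻¹) • U.driftMap (X n ω)

/-- The one-step errors propagated by the mean evolution. -/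
noncomputable def errPart (U : PolyaUrn q) (b : ℝ) (X : ℕ → Ω → EuclideanSpace ℝ (Fin q)) :
    ℕ → Ω → EuclideanSpace ℝ (Fin q)
  | 0, _ => 0
  | n + 1, ω => U.stepMap b n (U.errPart b X n ω) + U.stepErr b X n ω

theorem nonExtinct_anti (U : PolyaUrn q) (X : ℕ → Ω → EuclideanSpace ℝ (Fin q)) (n : ℕ) :
    U.nonExtinct X (n + 1) ⊆ U.nonExtinct X n := fun _ h k hk => h k (hk.trans n.le_succ)

/-- Variation of constants. The identity is confined to non-extinction, but both random parts are
defined everywhere, so their `L^p` bounds need no conditioning. -/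
theorem eq_add_of_mem_nonExtinct (U : PolyaUrn q) (b : ℝ)
    {X : ℕ → Ω → EuclideanSpace ℝ (Fin q)} {ω : Ω} (h0 : X 0 ω = U.x₀) {n : ℕ}
    (hω : ω ∈ U.nonExtinct X n) :
    X n ω = U.meanPath b n + (U.martPart b X n ω + U.errPart b X n ω) := by
  induction n with
  | zero => simp [meanPath, martPart, errPart, h0]
  | succ n ih =>
    have hω' := U.nonExtinct_anti X n hω
    have hS : 0 < U.activity (X n ω) := hω' n le_rfl
    have h := ih hω'
    have hs := congrArg (U.stepMap b n) h
    simp only [map_add] at hs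
    simp only [meanPath, martPart, errPart, stepErr, Set.indicator_of_mem hω', noise, if_pos hS]
    have e : U.stepMap b n (U.meanPath b n) + (U.stepMap b n (U.martPart b X n ω) +
        (X (n + 1) ω - X n ω - (U.activity (X n ω))⁻¹ • U.driftMap (X n ω)) +
        (U.stepMap b n (U.errPart b X n ω) +
          ((U.activity (X n ω))⁻¹ - (U.scale b n)⁻¹) • U.driftMap (X n ω))) =
        U.stepMap b n (X n ω) + (X (n + 1) ω - X n ω - (U.scale b n)⁻¹ • U.driftMap (X n ω)) := by
      rw [hs, sub_smul]; abel
    rw [e, stepMap_apply]; abel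

/-- The normalised drift has activity exactly `b`, so no linearisation error enters here and the
estimate is not circular. -/
theorem Cond.activity_sub_scale {U : PolyaUrn q} {b p : ℝ} (hU : U.Cond b p) (hp : 2 ≤ p)
    {X : ℕ → Ω → EuclideanSpace ℝ (Fin q)} {ω : Ω} (h0 : X 0 ω = U.x₀) {n : ℕ}
    (hω : ω ∈ U.nonExtinct X n) :
    U.activity (X n ω) - U.scale b n = U.activity (U.noiseSum X n ω) := by
  induction n with
  | zero =>
    have : U.activity (0 : EuclideanSpace ℝ (Fin q)) = 0 := U.activityCLM.map_zero
    simp [noiseSum, scale, h0, this]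
  | succ n ih =>
    have hω' := U.nonExtinct_anti X n hω
    have hS : 0 < U.activity (X n ω) := hω' n le_rfl
    have h := ih hω'
    rw [noiseSum, activity_add, ← h, noise, if_pos hS, activity_sub, activity_sub, activity_smul,
      hU.activity_driftMap hp, scale, scale]
    push_cast
    field_simp
    ring

theorem measurable_noise_past (U : PolyaUrn q) (X : ℕ → Ω → EuclideanSpace ℝ (Fin q)) (n : ℕ) :
    Measurable[past X (n + 1)] fun ω => U.noise (X n ω) (X (n + 1) ω - X n ω) :=
  have h1 := measurable_past X n.le_succ
  have h2 := measurable_past X (le_refl (n + 1))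
  U.measurable_noise.comp (h1.prodMk (h2.sub h1))

theorem measurable_noiseSum (U : PolyaUrn q) (X : ℕ → Ω → EuclideanSpace ℝ (Fin q)) (n : ℕ) :
    Measurable[past X n] (U.noiseSum X n) := by
  induction n with
  | zero => exact measurable_const
  | succ n ih => exact (ih.mono (past_mono X n.le_succ) le_rfl).add (U.measurable_noise_past X n)

theorem measurable_stepMap_martPart (U : PolyaUrn q) (b : ℝ)
    (X : ℕ → Ω → EuclideanSpace ℝ (Fin q)) (n : ℕ) :
    Measurable[past X n] fun ω => U.stepMap b n (U.martPart b X n ω) := by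
  suffices h : Measurable[past X n] (U.martPart b X n) from
    (U.stepMap b n).continuous.measurable.comp h
  induction n with
  | zero => exact measurable_const
  | succ n ih =>
    exact (((U.stepMap b n).continuous.measurable.comp ih).mono (past_mono X n.le_succ) le_rfl).add
      (U.measurable_noise_past X n)

theorem measurable_martPart (U : PolyaUrn q) (b : ℝ)
    (X : ℕ → Ω → EuclideanSpace ℝ (Fin q)) (n : ℕ) :
    Measurable[past X n] (U.martPart b X n) := by
  cases n with
  | zero => exact measurable_const
  | succ n =>
    exact ((U.measurable_stepMap_martPart b X n).mono (past_mono X n.le_succ) le_rfl).add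
      (U.measurable_noise_past X n)

theorem measurable_stepErr (U : PolyaUrn q) (b : ℝ) (X : ℕ → Ω → EuclideanSpace ℝ (Fin q))
    (n : ℕ) : Measurable[past X n] (U.stepErr b X n) := by
  have hX := measurable_past X (le_refl n)
  refine Measurable.indicator ?_ (U.measurableSet_nonExtinct X le_rfl)
  exact ((U.measurable_activity.comp hX).inv.sub measurable_const).smul
    (U.driftMap.continuous.measurable.comp hX)

theorem measurable_errPart (U : PolyaUrn q) (b : ℝ) (X : ℕ → Ω → EuclideanSpace ℝ (Fin q))
    (n : ℕ) : Measurable[past X n] (U.errPart b X n) := by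
  induction n with
  | zero => exact measurable_const
  | succ n ih =>
    exact (((U.stepMap b n).continuous.measurable.comp ih).add (U.measurable_stepErr b X n)).mono
      (past_mono X n.le_succ) le_rfl

/-- The constant in the `L^p` bound for the one-step errors. -/
noncomputable def errConst (U : PolyaUrn q) (b p : ℝ) : ℝ :=
  U.meanBound / min (U.activity U.x₀) b * √(U.noiseConst p * (‖U.activityCLM‖ + 1) ^ 2)

theorem errConst_nonneg (U : PolyaUrn q) {b p : ℝ} (hb : 0 < b) :
    0 ≤ U.errConst b p := by
  have h1 : 0 < min (U.activity U.x₀) b := lt_min U.x₀_active hb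
  have := U.meanBound_nonneg
  unfold errConst
  positivity

namespace IsRealization

variable {U : PolyaUrn q} [MeasurableSpace Ω] {μ : Measure Ω}
  [IsProbabilityMeasure μ] {X : ℕ → Ω → EuclideanSpace ℝ (Fin q)} {b p : ℝ}
  {H : Type*} [NormedAddCommGroup H] [InnerProductSpace ℝ H]

/-- Adding the noise of one step to a vector known from the past raises the squared `L^p` norm by
at most a constant. -/
theorem eLpNorm_add_noise_le [CompleteSpace H] (hX : U.IsRealization μ X) (hU : U.Cond b p) (hp : 2 ≤ p) {n : ℕ}
    {W : Ω → EuclideanSpace ℝ (Fin q)} (hW : Measurable[past X n] W)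
    (Q : EuclideanSpace ℝ (Fin q) →L[ℝ] H) {R u : ℝ} (hR : 0 ≤ R) (hQ : ∀ x, ‖Q x‖ ≤ R * ‖x‖)
    (hu : 0 < u)
    (h : eLpNorm (fun ω => Q (W ω)) (ENNReal.ofReal p) μ ≤ ENNReal.ofReal (√u)) :
    eLpNorm (fun ω => Q (W ω + U.noise (X n ω) (X (n + 1) ω - X n ω))) (ENNReal.ofReal p) μ ≤
      ENNReal.ofReal (√(u + U.noiseConst p * R ^ 2)) := by
  have hpos := hX.ae_nonneg hU.tenable n
  set B := U.momentBound p + U.meanBound with hBdef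
  have hB : 0 ≤ B := add_nonneg (U.momentBound_nonneg p) U.meanBound_nonneg
  have hC := smoothConst_pos hp
  refine (eLpNorm_le_sqrt_of_smooth (B := R * B) hp hu (by positivity) h ?_).trans
    (ENNReal.ofReal_le_ofReal (Real.sqrt_le_sqrt ?_))
  · have hf : Measurable fun z : (EuclideanSpace ℝ (Fin q) × EuclideanSpace ℝ (Fin q)) ×
        EuclideanSpace ℝ (Fin q) => ‖Q (z.1.1 + U.noise z.1.2 z.2)‖ₑ ^ p := by
      have h1 : Measurable fun x => ‖Q x‖ₑ ^ p := (Q.continuous.enorm.measurable).pow_const p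
      refine h1.comp (measurable_fst.fst.add ?_)
      exact U.measurable_noise.comp (measurable_fst.snd.prodMk measurable_snd)
    have := hX.lintegral_past_change hpos hW hf
    simp only at this
    rw [this]
    refine lintegral_mono_ae (hpos.mono fun ω hω => ?_)
    obtain ⟨h1, h2, h3⟩ := hU.noise_spec hp hω
    simp_rw [map_add]
    refine lintegral_enorm_add_rpow_le hp (by positivity) (Q.comp_memLp' h1) ?_ ?_ _
    · have hpp : 1 ≤ ENNReal.ofReal p := by
        rw [← ENNReal.ofReal_one]; exact ENNReal.ofReal_le_ofReal (by linarith)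
      have := Q.integral_comp_comm (h1.integrable hpp)
      rw [h2, map_zero] at this
      exact this
    · refine (eLpNorm_le_mul_eLpNorm_of_ae_le_mul (ae_of_all _ fun y => hQ _) _).trans ?_
      rw [ENNReal.ofReal_mul hR]
      gcongr
  · have : 0 ≤ R ^ 2 := by positivity
    rw [noiseConst, ← hBdef]
    nlinarith

theorem eLpNorm_noiseSum_le [CompleteSpace H] (hX : U.IsRealization μ X) (hU : U.Cond b p) (hp : 2 ≤ p)
    (Q : EuclideanSpace ℝ (Fin q) →L[ℝ] H) {R : ℝ} (hR : 0 < R) (hQ : ∀ x, ‖Q x‖ ≤ R * ‖x‖)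
    (n : ℕ) :
    eLpNorm (fun ω => Q (U.noiseSum X n ω)) (ENNReal.ofReal p) μ ≤
      ENNReal.ofReal (√(U.noiseConst p * R ^ 2 * (n + 1))) := by
  have hC := U.noiseConst_pos hp
  induction n with
  -- The bound carries `n + 1` instead of `n` because the inductive step needs a positive bound even
  -- at time `0`.
  | zero => simp [noiseSum]
  | succ n ih =>
    refine (hX.eLpNorm_add_noise_le hU hp (U.measurable_noiseSum X n) Q hR.le hQ
      (by positivity) ih).trans (le_of_eq ?_)
    congr 2; push_cast; ring

/-- Divided by `ρ n`, the propagated noise gains at most a multiple of `(ρ j ^ 2)⁻¹` in squared norm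
at step `j`. -/
theorem eLpNorm_martPart_le [CompleteSpace H] (hX : U.IsRealization μ X) (hU : U.Cond b p) (hp : 2 ≤ p)
    (Q : EuclideanSpace ℝ (Fin q) →L[ℝ] H) {R : ℝ} (hR : 0 < R) (hQ : ∀ x, ‖Q x‖ ≤ R * ‖x‖)
    {ρ : ℕ → ℝ} (hρ : ∀ k, 0 < ρ k)
    (hQρ : ∀ k x, ‖Q (U.stepMap b k x)‖ ≤ ρ (k + 1) / ρ k * ‖Q x‖) (n : ℕ) :
    eLpNorm (fun ω => Q (U.martPart b X n ω)) (ENNReal.ofReal p) μ ≤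
      ENNReal.ofReal (R * ρ n *
        √(U.noiseConst p * ∑ j ∈ Finset.range (n + 1), (ρ j ^ 2)⁻¹)) := by
  have hC := U.noiseConst_pos hp
  have hsum : ∀ n, 0 < ∑ j ∈ Finset.range (n + 1), (ρ j ^ 2)⁻¹ := fun n =>
    Finset.sum_pos (fun j _ => by have := hρ j; positivity) Finset.nonempty_range_add_one
  have e : ∀ n, R * ρ n * √(U.noiseConst p * ∑ j ∈ Finset.range (n + 1), (ρ j ^ 2)⁻¹) =
      √(R ^ 2 * ρ n ^ 2 * (U.noiseConst p * ∑ j ∈ Finset.range (n + 1), (ρ j ^ 2)⁻¹)) := fun n => by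
    have := hρ n
    rw [← mul_pow, Real.sqrt_mul (sq_nonneg _), Real.sqrt_sq (by positivity)]
  induction n with
  | zero => simp [martPart]
  | succ n ih =>
    have h1 := hρ n
    have h2 := hρ (n + 1)
    have h3 := hsum n
    have hW : eLpNorm (fun ω => Q (U.stepMap b n (U.martPart b X n ω))) (ENNReal.ofReal p) μ ≤
        ENNReal.ofReal (√(R ^ 2 * ρ (n + 1) ^ 2 *
          (U.noiseConst p * ∑ j ∈ Finset.range (n + 1), (ρ j ^ 2)⁻¹))) := by
      refine (eLpNorm_le_mul_eLpNorm_of_ae_le_mul (ae_of_all _ fun ω => hQρ n _) _).trans ?_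
      refine (mul_le_mul_right ih _).trans (le_of_eq ?_)
      rw [← ENNReal.ofReal_mul (by positivity)]
      congr 1
      rw [← mul_pow, Real.sqrt_mul (sq_nonneg _), Real.sqrt_sq (by positivity)]
      field_simp
    refine (hX.eLpNorm_add_noise_le hU hp (U.measurable_stepMap_martPart b X n) Q hR.le hQ
      (by positivity) hW).trans (le_of_eq ?_)
    rw [e, Finset.sum_range_succ _ (n + 1)]
    congr 2
    field_simp

theorem eLpNorm_activity_sub_scale_le (hX : U.IsRealization μ X) (hU : U.Cond b p) (hp : 2 ≤ p)
    (n : ℕ) :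
    eLpNorm ((U.nonExtinct X n).indicator fun ω => U.activity (X n ω) - U.scale b n)
      (ENNReal.ofReal p) μ ≤
      ENNReal.ofReal (√(U.noiseConst p * (‖U.activityCLM‖ + 1) ^ 2 * (n + 1))) := by
  refine le_trans (eLpNorm_mono_ae (hX.init.mono fun ω h0 => ?_))
    (hX.eLpNorm_noiseSum_le hU hp U.activityCLM (R := ‖U.activityCLM‖ + 1) (by positivity)
      (fun x => (U.activityCLM.le_opNorm x).trans (by gcongr; linarith)) n)
  by_cases hω : ω ∈ U.nonExtinct X n
  · rw [Set.indicator_of_mem hω, hU.activity_sub_scale hp h0 hω]; rfl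
  · rw [Set.indicator_of_notMem hω]; simp

theorem eLpNorm_stepErr_le (hX : U.IsRealization μ X) (hU : U.Cond b p) (hp : 2 ≤ p) (n : ℕ) :
    eLpNorm (U.stepErr b X n) (ENNReal.ofReal p) μ ≤
      ENNReal.ofReal (U.errConst b p / √(n + 1)) := by
  have hb := hU.balanced.1
  have hw := U.scale_pos hb n
  have hmin : 0 < min (U.activity U.x₀) b := lt_min U.x₀_active hb
  have hmb := U.meanBound_nonneg
  have hwn : min (U.activity U.x₀) b * (n + 1) ≤ U.scale b n := by
    have h1 := min_le_left (U.activity U.x₀) b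
    have h2 := mul_le_mul_of_nonneg_right (min_le_right (U.activity U.x₀) b) n.cast_nonneg (α := ℝ)
    unfold scale
    linarith
  have hle : ∀ᵐ ω ∂μ, ‖U.stepErr b X n ω‖ ≤ U.meanBound / (min (U.activity U.x₀) b * (n + 1)) *
      ‖(U.nonExtinct X n).indicator (fun ω => U.activity (X n ω) - U.scale b n) ω‖ := by
    filter_upwards [hX.ae_nonneg hU.tenable n] with ω hω
    by_cases hmem : ω ∈ U.nonExtinct X n
    · have hS : 0 < U.activity (X n ω) := hmem n le_rfl
      rw [stepErr, Set.indicator_of_mem hmem, Set.indicator_of_mem hmem, norm_smul]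
      have e : (U.activity (X n ω))⁻¹ - (U.scale b n)⁻¹ =
          -(U.activity (X n ω) - U.scale b n) / (U.activity (X n ω) * U.scale b n) := by
        field_simp; ring
      rw [e, norm_div, norm_neg, norm_mul, Real.norm_of_nonneg hS.le, Real.norm_of_nonneg hw.le]
      -- The random activity in the denominator cancels against the bound for the drift.
      calc _ ≤ ‖U.activity (X n ω) - U.scale b n‖ / (U.activity (X n ω) * U.scale b n) *
            (U.activity (X n ω) * U.meanBound) := by gcongr; exact U.norm_driftMap_le hω
        _ = U.meanBound / U.scale b n * ‖U.activity (X n ω) - U.scale b n‖ := by field_simp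
        _ ≤ _ := by gcongr
    · rw [stepErr, Set.indicator_of_notMem hmem, Set.indicator_of_notMem hmem]; simp
  refine (eLpNorm_le_mul_eLpNorm_of_ae_le_mul hle _).trans
    ((mul_le_mul_right (hX.eLpNorm_activity_sub_scale_le hU hp n) _).trans (le_of_eq ?_))
  have hn : (0 : ℝ) < n + 1 := by positivity
  rw [← ENNReal.ofReal_mul (by positivity), Real.sqrt_mul (by have := U.noiseConst_pos hp; positivity)
    (n + 1 : ℝ), errConst]
  congr 1
  have := Real.mul_self_sqrt hn.le
  have hsq : 0 < √((n : ℝ) + 1) := Real.sqrt_pos.2 hn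
  generalize √((n : ℝ) + 1) = x at this hsq ⊢
  rw [← this]
  field_simp

/-- The errors are not centred, so they are added by the triangle inequality and not in squares. -/
theorem eLpNorm_errPart_le (hX : U.IsRealization μ X) (hU : U.Cond b p) (hp : 2 ≤ p)
    (Q : EuclideanSpace ℝ (Fin q) →L[ℝ] H) {R : ℝ} (hR : 0 < R) (hQ : ∀ x, ‖Q x‖ ≤ R * ‖x‖)
    {ρ : ℕ → ℝ} (hρ : ∀ k, 0 < ρ k)
    (hQρ : ∀ k x, ‖Q (U.stepMap b k x)‖ ≤ ρ (k + 1) / ρ k * ‖Q x‖) (n : ℕ) :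
    eLpNorm (fun ω => Q (U.errPart b X n ω)) (ENNReal.ofReal p) μ ≤
      ENNReal.ofReal (R * ρ n *
        (U.errConst b p * ∑ j ∈ Finset.range n, (ρ (j + 1) * √(j + 1))⁻¹)) := by
  have hE := U.errConst_nonneg (p := p) hU.balanced.1
  have hsum : ∀ n, 0 ≤ ∑ j ∈ Finset.range n, (ρ (j + 1) * √((j : ℝ) + 1))⁻¹ := fun n =>
    Finset.sum_nonneg fun j _ => by have := hρ (j + 1); positivity
  have hpp : 1 ≤ ENNReal.ofReal p := by
    rw [← ENNReal.ofReal_one]; exact ENNReal.ofReal_le_ofReal (by linarith)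
  induction n with
  | zero => simp [errPart]
  | succ n ih =>
    have h1 := hρ n
    have h2 := hρ (n + 1)
    have h3 := hsum n
    have m1 : Measurable fun ω => U.stepMap b n (U.errPart b X n ω) :=
      (U.stepMap b n).continuous.measurable.comp
        ((U.measurable_errPart b X n).mono (hX.past_le n) le_rfl)
    have m2 : Measurable (U.stepErr b X n) :=
      (U.measurable_stepErr b X n).mono (hX.past_le n) le_rfl
    simp only [errPart, map_add]
    refine (eLpNorm_add_le (Q.continuous.comp_aestronglyMeasurable m1.aestronglyMeasurable)
      (Q.continuous.comp_aestronglyMeasurable m2.aestronglyMeasurable) hpp).trans ?_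
    have b1 : eLpNorm (fun ω => Q (U.stepMap b n (U.errPart b X n ω))) (ENNReal.ofReal p) μ ≤
        ENNReal.ofReal (R * ρ (n + 1) *
        (U.errConst b p * ∑ j ∈ Finset.range n, (ρ (j + 1) * √((j : ℝ) + 1))⁻¹)) := by
      refine (eLpNorm_le_mul_eLpNorm_of_ae_le_mul (ae_of_all _ fun ω => hQρ n _) _).trans ?_
      refine (mul_le_mul_right ih _).trans (le_of_eq ?_)
      rw [← ENNReal.ofReal_mul (by positivity)]
      congr 1
      field_simp
    have b2 : eLpNorm (fun ω => Q (U.stepErr b X n ω)) (ENNReal.ofReal p) μ ≤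
        ENNReal.ofReal (R * (U.errConst b p / √((n : ℝ) + 1))) := by
      refine (eLpNorm_le_mul_eLpNorm_of_ae_le_mul (ae_of_all _ fun ω => hQ _) _).trans ?_
      rw [ENNReal.ofReal_mul hR.le]
      exact mul_le_mul_right (hX.eLpNorm_stepErr_le hU hp n) _
    refine (add_le_add b1 b2).trans (le_of_eq ?_)
    rw [← ENNReal.ofReal_add (by positivity) (by positivity), Finset.sum_range_succ]
    congr 1
    have : 0 < √((n : ℝ) + 1) := by positivity
    field_simp

/-- The general bound for a linear image of the urn whose mean evolution grows at rate `ρ`. -/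
theorem eLpNorm_sub_meanPath_le [CompleteSpace H] (hX : U.IsRealization μ X) (hU : U.Cond b p) (hp : 2 ≤ p)
    (Q : EuclideanSpace ℝ (Fin q) →L[ℝ] H) {R : ℝ} (hR : 0 < R) (hQ : ∀ x, ‖Q x‖ ≤ R * ‖x‖)
    {ρ : ℕ → ℝ} (hρ : ∀ k, 0 < ρ k)
    (hQρ : ∀ k x, ‖Q (U.stepMap b k x)‖ ≤ ρ (k + 1) / ρ k * ‖Q x‖) (n : ℕ) :
    eLpNorm ((U.nonExtinct X n).indicator fun ω => Q (X n ω - U.meanPath b n))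
      (ENNReal.ofReal p) μ ≤ ENNReal.ofReal (R * ρ n *
        (√(U.noiseConst p * ∑ j ∈ Finset.range (n + 1), (ρ j ^ 2)⁻¹) +
          U.errConst b p * ∑ j ∈ Finset.range n, (ρ (j + 1) * √(j + 1))⁻¹)) := by
  have hE := U.errConst_nonneg (p := p) hU.balanced.1
  have hρn := hρ n
  have hsum : 0 ≤ ∑ j ∈ Finset.range n, (ρ (j + 1) * √((j : ℝ) + 1))⁻¹ :=
    Finset.sum_nonneg fun j _ => by have := hρ (j + 1); positivity
  have hpp : 1 ≤ ENNReal.ofReal p := by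
    rw [← ENNReal.ofReal_one]; exact ENNReal.ofReal_le_ofReal (by linarith)
  have m1 := (U.measurable_martPart b X n).mono (hX.past_le n) le_rfl
  have m2 := (U.measurable_errPart b X n).mono (hX.past_le n) le_rfl
  rw [mul_add, ENNReal.ofReal_add (by positivity) (by positivity)]
  refine le_trans (eLpNorm_mono_ae (g := fun ω => Q (U.martPart b X n ω) + Q (U.errPart b X n ω))
    (hX.init.mono fun ω h0 => ?_)) ((eLpNorm_add_le
      (Q.continuous.comp_aestronglyMeasurable m1.aestronglyMeasurable)
      (Q.continuous.comp_aestronglyMeasurable m2.aestronglyMeasurable) hpp).trans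
    (add_le_add (hX.eLpNorm_martPart_le hU hp Q hR hQ hρ hQρ n)
      (hX.eLpNorm_errPart_le hU hp Q hR hQ hρ hQρ n)))
  by_cases hω : ω ∈ U.nonExtinct X n
  · rw [Set.indicator_of_mem hω, U.eq_add_of_mem_nonExtinct b h0 hω, add_sub_cancel_left, map_add]
  · rw [Set.indicator_of_notMem hω]; simp

end IsRealization

end PolyaUrn

/-! ### Spectral projections and nilpotent parts. -/

section Spectral

variable {V : Type*} [AddCommGroup V] [Module ℂ V] [FiniteDimensional ℂ V]

theorem spectralProj_mem (T : Module.End ℂ V) (z : ℂ) (x : V) :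
    spectralProj T z x ∈ T.maxGenEigenspace z :=
  Submodule.projection_apply_mem _ x

theorem spectralProj_apply_of_mem (T : Module.End ℂ V) {z : ℂ} {x : V}
    (hx : x ∈ T.maxGenEigenspace z) : spectralProj T z x = x :=
  Submodule.projection_apply_of_mem_left _ hx

theorem sub_spectralProj_mem (T : Module.End ℂ V) (z : ℂ) (x : V) :
    x - spectralProj T z x ∈ ⨆ (w : ℂ) (_ : w ≠ z), T.maxGenEigenspace w :=
  Submodule.sub_projection_mem _ x

theorem commute_spectralProj (T : Module.End ℂ V) (z : ℂ) : Commute (spectralProj T z) T := by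
  have hmaps : ∀ w, T.maxGenEigenspace w ∈ Module.End.invtSubmodule T := fun w x hx =>
    Module.End.mapsTo_maxGenEigenspace_of_comm (Commute.refl T) w hx
  refine (LinearMap.IsIdempotentElem.commute_iff
    (Submodule.isIdempotentElem_projection (isCompl_maxGenEigenspace T z))).2 ⟨?_, ?_⟩
  · rw [Submodule.range_projection]; exact hmaps z
  · rw [Submodule.ker_projection, Module.End.mem_invtSubmodule]
    refine iSup₂_le fun w hw => ?_
    exact ((Module.End.mem_invtSubmodule T).1 (hmaps w)).trans (Submodule.comap_mono
      (le_iSup₂ (f := fun (w : ℂ) (_ : w ≠ z) => T.maxGenEigenspace w) w hw))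

theorem spectralProj_map (T : Module.End ℂ V) (z : ℂ) (x : V) :
    spectralProj T z (T x) = T (spectralProj T z x) :=
  LinearMap.congr_fun (commute_spectralProj T z) x

/-- The nilpotent part of `T` at `z`. -/
noncomputable def nilPart (T : Module.End ℂ V) (z : ℂ) : Module.End ℂ V :=
  (T - algebraMap ℂ (Module.End ℂ V) z) * spectralProj T z

theorem nilPart_spectralProj (T : Module.End ℂ V) (z : ℂ) (x : V) :
    nilPart T z (spectralProj T z x) = T (spectralProj T z x) - z • spectralProj T z x := by
  simp [nilPart, spectralProj_apply_of_mem T (spectralProj_mem T z x)]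

theorem nilPart_pow_succ_jordanNu (T : Module.End ℂ V) (z : ℂ) :
    nilPart T z ^ (jordanNu T z + 1) = 0 := by
  have hnil : IsNilpotent (nilPart T z) := by
    -- The additional power guarantees a factor of the projection even in dimension `0`.
    refine ⟨Module.finrank ℂ V + 1, ?_⟩
    have hcomm : Commute (T - algebraMap ℂ (Module.End ℂ V) z) (spectralProj T z) :=
      (commute_spectralProj T z).symm.sub_left (Algebra.commute_algebraMap_left z _)
    rw [nilPart, hcomm.mul_pow]
    ext x
    have h1 : (spectralProj T z ^ (Module.finrank ℂ V + 1)) x ∈ T.maxGenEigenspace z := by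
      rw [pow_succ']; exact spectralProj_mem T z _
    rw [Module.End.maxGenEigenspace_eq_genEigenspace_finrank,
      Module.End.mem_genEigenspace_nat] at h1
    rw [Module.End.mul_apply, pow_succ', Module.End.mul_apply, Algebra.algebraMap_eq_smul_one,
      LinearMap.mem_ker.1 h1]
    simp
  have h := pow_nilpotencyClass hnil
  exact pow_eq_zero_of_le (by change _ ≤ nilpotencyClass (nilPart T z) - 1 + 1; omega) h

end Spectral

section ToComplex

variable {q : ℕ}

/-- The inclusion of real vectors in complex vectors as a real-linear map. -/
noncomputable def toComplexCLM (q : ℕ) : EuclideanSpace ℝ (Fin q) →L[ℝ] EuclideanSpace ℂ (Fin q) :=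
  LinearMap.toContinuousLinearMap
    { toFun := toComplexVec
      map_add' := fun x y => by ext i; simp [toComplexVec]
      map_smul' := fun c x => by ext i; simp [toComplexVec] }

@[simp]
theorem toComplexCLM_apply (x : EuclideanSpace ℝ (Fin q)) : toComplexCLM q x = toComplexVec x := rfl

/-- A complex endomorphism of `ℂ^q` as a continuous real-linear map. -/
noncomputable def realCLM (B : Module.End ℂ (EuclideanSpace ℂ (Fin q))) :
    EuclideanSpace ℂ (Fin q) →L[ℝ] EuclideanSpace ℂ (Fin q) :=
  (LinearMap.toContinuousLinearMap B).restrictScalars ℝ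

@[simp]
theorem realCLM_apply (B : Module.End ℂ (EuclideanSpace ℂ (Fin q)))
    (x : EuclideanSpace ℂ (Fin q)) : realCLM B x = B x := rfl

end ToComplex

/-! ### Growth of one Jordan block under the mean evolution. -/

namespace PolyaUrn

variable {q : ℕ}

theorem Cond.op_toComplexVec {U : PolyaUrn q} {b p : ℝ} (hU : U.Cond b p) (hp : 2 ≤ p)
    (x : EuclideanSpace ℝ (Fin q)) : U.op (toComplexVec x) = toComplexVec (U.driftMap x) := by
  ext i
  simp only [op, Matrix.toLpLin_apply, toComplexVec, Matrix.mulVec, dotProduct, intensity,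
    Matrix.of_apply, driftMap_apply]
  simp only [WithLp.ofLp_sum, WithLp.ofLp_smul, Finset.sum_apply, Pi.smul_apply, smul_eq_mul,
    hU.meanVec_apply hp]
  push_cast
  exact Finset.sum_congr rfl fun j _ => by ring

/-- From `‖1 + z‖ ≤ (1 + ‖1 + z‖²) / 2` and `1 + t ≤ exp t`: the growth factor depends on `Re z` to
first order. -/
theorem norm_one_add_add_le (z : ℂ) (h : ℝ) :
    ‖1 + z‖ + h ≤ Real.exp (z.re + ‖z‖ ^ 2 / 2 + h) := by
  have h1 : ‖1 + z‖ ^ 2 = 1 + 2 * z.re + ‖z‖ ^ 2 := by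
    rw [Complex.sq_norm, Complex.sq_norm, Complex.normSq_apply, Complex.normSq_apply]
    simp; ring
  have h2 : ‖1 + z‖ ≤ 1 + z.re + ‖z‖ ^ 2 / 2 := by nlinarith [sq_nonneg (‖1 + z‖ - 1)]
  have := Real.add_one_le_exp (z.re + ‖z‖ ^ 2 / 2 + h)
  linarith

section Resolve

/-- The powers of the nilpotent part of `T` at `z`, applied to the spectral projection and weighted
with powers of `L`. -/
noncomputable def resolve (T : Module.End ℂ (EuclideanSpace ℂ (Fin q))) (z : ℂ) (L : ℝ) (d : ℕ) :
    EuclideanSpace ℝ (Fin q) →L[ℝ] PiLp 2 fun _ : Fin d => EuclideanSpace ℂ (Fin q) :=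
  LinearMap.toContinuousLinearMap
    { toFun := fun x => WithLp.toLp 2 fun m =>
        L ^ (m : ℕ) • realCLM (nilPart T z ^ (m : ℕ) * spectralProj T z) (toComplexCLM q x)
      map_add' := fun x y => by ext1 m; simp only [map_add, smul_add]; rfl
      map_smul' := fun c x => by
        ext1 m
        simp only [map_smul, RingHom.id_apply, PiLp.smul_apply]
        rw [smul_comm] }

variable (T : Module.End ℂ (EuclideanSpace ℂ (Fin q))) (z : ℂ) (L : ℝ)

theorem resolve_apply (d : ℕ) (x : EuclideanSpace ℝ (Fin q)) (m : Fin d) :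
    resolve T z L d x m =
      L ^ (m : ℕ) • (nilPart T z ^ (m : ℕ)) (spectralProj T z (toComplexVec x)) := rfl

theorem norm_spectralProj_le_resolve (d : ℕ) (x : EuclideanSpace ℝ (Fin q)) :
    ‖spectralProj T z (toComplexVec x)‖ ≤ ‖resolve T z L (d + 1) x‖ := by
  have h := PiLp.norm_apply_le (resolve T z L (d + 1) x) 0
  simpa [resolve_apply] using h

/-- `R` must not depend on `L`, since `L` will be allowed to grow with `n`; the factor `L ^ d` is
the source of `(log n) ^ ν`. -/
theorem exists_norm_resolve_le (d : ℕ) : ∃ R > 0, ∀ L : ℝ, 1 ≤ L → ∀ x,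
    ‖resolve T z L (d + 1) x‖ ≤ R * L ^ d * ‖x‖ := by
  set r : Fin (d + 1) → ℝ := fun m =>
    ‖(realCLM (nilPart T z ^ (m : ℕ) * spectralProj T z)).comp (toComplexCLM q)‖
  have hr : ∀ m, 0 ≤ r m := fun m => norm_nonneg _
  have hrs : 0 ≤ ∑ m, r m := Finset.sum_nonneg fun m _ => hr m
  refine ⟨∑ m, r m + 1, by positivity, fun L hL x => ?_⟩
  have hm : ∀ m, ‖resolve T z L (d + 1) x m‖ ≤ L ^ d * r m * ‖x‖ := fun m => by
    have h := ((realCLM (nilPart T z ^ (m : ℕ) * spectralProj T z)).comp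
      (toComplexCLM q)).le_opNorm x
    rw [resolve_apply, norm_smul, Real.norm_of_nonneg (by positivity), mul_assoc]
    refine mul_le_mul (pow_le_pow_right₀ hL (by omega)) h (norm_nonneg _) (by positivity)
  have h0 : 0 ≤ (∑ m, r m + 1) * L ^ d * ‖x‖ := by positivity
  refine le_of_sq_le_sq ?_ h0
  rw [PiLp.norm_sq_eq_of_L2]
  calc ∑ m, ‖resolve T z L (d + 1) x m‖ ^ 2 ≤ (∑ m, ‖resolve T z L (d + 1) x m‖) ^ 2 :=
        Finset.sum_sq_le_sq_sum_of_nonneg fun _ _ => norm_nonneg _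
    _ ≤ ((∑ m, r m + 1) * L ^ d * ‖x‖) ^ 2 := by
        gcongr
        refine (Finset.sum_le_sum fun m _ => hm m).trans ?_
        rw [← Finset.sum_mul, ← Finset.mul_sum, mul_comm (L ^ d)]
        gcongr
        linarith

/-- On the range of the projection the operator is `z + N`, and `N` sends coordinate `m` to `L⁻¹`
times coordinate `m + 1`. The shift therefore costs only `1 / (L w)`, and it ends because `N ^ (ν +
1) = 0`. -/
theorem Cond.norm_resolve_stepMap_le {U : PolyaUrn q} {b p : ℝ} (hU : U.Cond b p) (hp : 2 ≤ p)
    (z : ℂ) {L : ℝ} (hL : 0 < L) (k : ℕ) (x : EuclideanSpace ℝ (Fin q)) :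
    ‖resolve U.op z L (jordanNu U.op z + 1) (U.stepMap b k x)‖ ≤
      Real.exp (z.re / U.scale b k + ‖z‖ ^ 2 / (2 * U.scale b k ^ 2) + 1 / (L * U.scale b k)) *
        ‖resolve U.op z L (jordanNu U.op z + 1) x‖ := by
  set w := U.scale b k with hw
  have hw0 : 0 < w := U.scale_pos hU.balanced.1 k
  set ν := jordanNu U.op z with hν
  set N := nilPart U.op z
  set y := spectralProj U.op z (toComplexVec x) with hy
  let S : PiLp 2 fun _ : Fin (ν + 1) => EuclideanSpace ℂ (Fin q) :=
    WithLp.toLp 2 fun m => L ^ (m : ℕ) • (N ^ (m + 1 : ℕ)) y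
  have hS : ‖S‖ ≤ L⁻¹ * ‖resolve U.op z L (ν + 1) x‖ := by
    refine le_of_sq_le_sq ?_ (by positivity)
    rw [mul_pow, PiLp.norm_sq_eq_of_L2, PiLp.norm_sq_eq_of_L2]
    have e1 : ∑ m, ‖S m‖ ^ 2 =
        ∑ m ∈ Finset.range (ν + 1), ‖L ^ m • (N ^ (m + 1)) y‖ ^ 2 :=
      Fin.sum_univ_eq_sum_range (fun m => ‖L ^ m • (N ^ (m + 1)) y‖ ^ 2) (ν + 1)
    have e2 : ∑ m, ‖resolve U.op z L (ν + 1) x m‖ ^ 2 =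
        ∑ m ∈ Finset.range (ν + 1), ‖L ^ m • (N ^ m) y‖ ^ 2 :=
      Fin.sum_univ_eq_sum_range (fun m => ‖L ^ m • (N ^ m) y‖ ^ 2) (ν + 1)
    rw [e1, e2, Finset.sum_range_succ, nilPart_pow_succ_jordanNu, Finset.sum_range_succ',
      mul_add, Finset.mul_sum]
    refine add_le_add (le_of_eq (Finset.sum_congr rfl fun m _ => ?_)) ?_
    · rw [norm_smul, norm_smul, Real.norm_of_nonneg (by positivity),
        Real.norm_of_nonneg (by positivity)]
      field_simp
      ring
    · simp; positivity
  have hQ : resolve U.op z L (ν + 1) (U.stepMap b k x) =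
      (1 + z / w) • resolve U.op z L (ν + 1) x + w⁻¹ • S := by
    ext1 m
    have hT : spectralProj U.op z (toComplexVec (U.stepMap b k x)) =
        y + (w⁻¹ : ℂ) • (z • y + N y) := by
      have h1 : toComplexVec (U.stepMap b k x) =
          toComplexVec x + (w⁻¹ : ℝ) • toComplexVec (U.driftMap x) := by
        rw [stepMap_apply]
        exact ((toComplexCLM q).map_add _ _).trans
          (congrArg _ ((toComplexCLM q).map_smul _ _))
      rw [h1, ← hU.op_toComplexVec hp, nilPart_spectralProj, ← spectralProj_map, map_add,
        ← Complex.coe_smul, map_smul]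
      push_cast
      congr 2
      abel
    rw [resolve_apply, hT, PiLp.add_apply, PiLp.smul_apply, PiLp.smul_apply, resolve_apply, ← hy]
    change _ = (1 + z / w) • (L ^ (m : ℕ) • (N ^ (m : ℕ)) y) +
      w⁻¹ • (L ^ (m : ℕ) • (N ^ (m + 1 : ℕ)) y)
    rw [pow_succ, Module.End.mul_apply]
    simp only [map_add, map_smul, ← Complex.coe_smul, smul_add, smul_smul]
    push_cast
    rw [← add_assoc, ← add_smul]
    congr 2 <;> ring
  rw [hQ]
  refine (norm_add_le _ _).trans ?_
  rw [norm_smul, norm_smul, Real.norm_of_nonneg (by positivity)]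
  have h1 : w⁻¹ * ‖S‖ ≤ 1 / (L * w) * ‖resolve U.op z L (ν + 1) x‖ := by
    refine (mul_le_mul_of_nonneg_left hS (by positivity)).trans (le_of_eq ?_)
    field_simp
  have h2 := norm_one_add_add_le (z / w) (1 / (L * w))
  have h3 : (z / (w : ℂ)).re + ‖z / (w : ℂ)‖ ^ 2 / 2 + 1 / (L * w) =
      z.re / w + ‖z‖ ^ 2 / (2 * w ^ 2) + 1 / (L * w) := by
    rw [Complex.div_ofReal_re, norm_div, Complex.norm_real, Real.norm_of_nonneg hw0.le, div_pow]
    field_simp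
  rw [h3] at h2
  have := mul_le_mul_of_nonneg_right h2 (norm_nonneg (resolve U.op z L (ν + 1) x))
  linarith

end Resolve

end PolyaUrn

/-! ### Growth rates, power sums and the choice of the weight `L`. -/

section Rates

/-- A sequence comparable to `(k + s) ^ κ`, with ratios of successive terms large enough to absorb
second-order terms. -/
noncomputable def rate (s κ C : ℝ) (k : ℕ) : ℝ :=
  (k + s) ^ κ * Real.exp (C * ∑ i ∈ Finset.range k, 1 / ((i : ℝ) + s) ^ 2)

theorem rate_pos {s : ℝ} (hs : 0 < s) (κ C : ℝ) (k : ℕ) : 0 < rate s κ C k := by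
  unfold rate; positivity

/-- With `t = 1 / (k + s)`, the error `log (1 + t) - t = O(t²)` and the term `D t²` are absorbed by
the exponential correction in `rate`. The correction stays bounded in `k`, uniformly in `κ`. -/
theorem exp_le_rate_ratio {s κ C D : ℝ} (hs : 0 < s) (hC : |κ| + D ≤ C) (k : ℕ) :
    Real.exp (κ / (k + s) + D / (k + s) ^ 2) ≤ rate s κ C (k + 1) / rate s κ C k := by
  have hx : (0 : ℝ) < k + s := by positivity
  have hx1 : (0 : ℝ) < k + 1 + s := by positivity
  set t : ℝ := 1 / (k + s) with ht
  have ht0 : 0 < t := by positivity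
  have e : rate s κ C (k + 1) / rate s κ C k = Real.exp (κ * Real.log (1 + t) + C * t ^ 2) := by
    have h1 : ((k : ℝ) + 1 + s) = (k + s) * (1 + t) := by rw [ht]; field_simp; ring
    rw [rate, rate, Finset.sum_range_succ, mul_add, Real.exp_add, Real.exp_add]
    push_cast
    rw [h1, Real.mul_rpow hx.le (by positivity), Real.rpow_def_of_pos (by positivity : 0 < 1 + t),
      mul_comm (Real.log (1 + t)), ht, one_div_pow]
    field_simp
  rw [e, Real.exp_le_exp]
  have hlow : t - t ^ 2 ≤ Real.log (1 + t) := by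
    have := Real.one_sub_inv_le_log_of_pos (by positivity : 0 < 1 + t)
    have h2 : t - t ^ 2 ≤ 1 - (1 + t)⁻¹ := by
      rw [← sub_nonneg]
      have : 1 - (1 + t)⁻¹ - (t - t ^ 2) = t ^ 3 / (1 + t) := by field_simp; ring
      rw [this]; positivity
    linarith
  have hup : Real.log (1 + t) ≤ t := by
    have := Real.log_le_sub_one_of_pos (by positivity : 0 < 1 + t)
    linarith
  have hκ : κ * t ≤ κ * Real.log (1 + t) + |κ| * t ^ 2 := by
    rcases le_total 0 κ with h | h
    · rw [abs_of_nonneg h]; nlinarith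
    · rw [abs_of_nonpos h]; nlinarith [sq_nonneg t]
  have h3 : κ / (k + s) + D / (k + s) ^ 2 = κ * t + D * t ^ 2 := by rw [ht]; field_simp
  rw [h3]
  nlinarith [sq_nonneg t]

theorem sum_inv_sq_le {s : ℝ} (hs : 0 < s) (n : ℕ) :
    ∑ i ∈ Finset.range n, 1 / ((i : ℝ) + s) ^ 2 ≤ 1 / s ^ 2 + 1 / s := by
  suffices h : ∀ n : ℕ, ∑ i ∈ Finset.range (n + 1), 1 / ((i : ℝ) + s) ^ 2 ≤
      1 / s ^ 2 + 1 / s - 1 / (n + s) by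
    refine (Finset.sum_le_sum_of_subset_of_nonneg
      (Finset.range_subset_range.2 n.le_succ) fun i _ _ => by positivity).trans ((h n).trans ?_)
    have : 0 ≤ 1 / ((n : ℝ) + s) := by positivity
    linarith
  intro n
  induction n with
  | zero => simp
  | succ n ih =>
    rw [Finset.sum_range_succ]
    push_cast
    have hx : (0 : ℝ) < n + s := by positivity
    have h : 1 / ((n : ℝ) + 1 + s) ^ 2 ≤ 1 / (n + s) - 1 / (n + 1 + s) := by
      rw [← sub_nonneg]
      have : 1 / ((n : ℝ) + s) - 1 / (n + 1 + s) - 1 / (n + 1 + s) ^ 2 =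
          1 / ((n + s) * (n + 1 + s) ^ 2) := by
        field_simp; ring
      rw [this]; positivity
    linarith

theorem le_rate {s C : ℝ} (hs : 0 < s) (hC : 0 ≤ C) (κ : ℝ) (k : ℕ) :
    ((k : ℝ) + s) ^ κ ≤ rate s κ C k := by
  unfold rate
  have h0 : 0 ≤ ∑ i ∈ Finset.range k, 1 / ((i : ℝ) + s) ^ 2 :=
    Finset.sum_nonneg fun i _ => by positivity
  exact le_mul_of_one_le_right (by positivity) (Real.one_le_exp (by positivity))

theorem rate_le {s C : ℝ} (hs : 0 < s) (hC : 0 ≤ C) (κ : ℝ) (k : ℕ) :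
    rate s κ C k ≤ ((k : ℝ) + s) ^ κ * Real.exp (C * (1 / s ^ 2 + 1 / s)) := by
  unfold rate
  gcongr
  exact sum_inv_sq_le hs k

/-- A partial sum of the series with terms `(j + s) ^ (-θ)`. -/
noncomputable def powerSum (s θ : ℝ) (n : ℕ) : ℝ :=
  ∑ j ∈ Finset.range (n + 1), ((j : ℝ) + s) ^ (-θ)

theorem powerSum_nonneg {s : ℝ} (hs : 0 < s) (θ : ℝ) (n : ℕ) : 0 ≤ powerSum s θ n :=
  Finset.sum_nonneg fun j _ => by positivity

/-- Discrete comparison with the integral. Negative `θ` must be allowed, since an eigenvalue may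
have negative real part; Bernoulli serves exponents `1 - θ ≤ 1` and monotonicity in the exponent the
others. -/
theorem powerSum_le_of_lt_one {s θ : ℝ} (hs : 0 < s) (hθ : θ < 1) :
    ∃ C, 0 ≤ C ∧ ∀ n : ℕ, powerSum s θ n ≤ C * ((n : ℝ) + s) ^ (1 - θ) := by
  have hr : 0 < 1 - θ := by linarith
  set r := 1 - θ with hrdef
  have hm : 0 < min 1 r := lt_min one_pos hr
  refine ⟨1 / min 1 r + 1 / s, by positivity, fun n => ?_⟩
  induction n with
  | zero =>
    have e : s ^ (-θ) = 1 / s * s ^ r := by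
      rw [one_div, ← Real.rpow_neg_one, ← Real.rpow_add hs]; congr 1; rw [hrdef]; ring
    simp only [powerSum, zero_add, Finset.range_one, Finset.sum_singleton, Nat.cast_zero]
    rw [e]
    gcongr
    have : 0 ≤ 1 / min 1 r := by positivity
    linarith
  | succ n ih =>
    rw [powerSum, Finset.sum_range_succ]
    change powerSum s θ n + _ ≤ _
    push_cast
    have hx : (0 : ℝ) < n + s := by positivity
    have hy : (0 : ℝ) < n + 1 + s := by positivity
    set y : ℝ := n + 1 + s with hydef
    have hxy : (n : ℝ) + s = y * (1 + -(1 / y)) := by rw [hydef]; field_simp; ring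
    have hy1 : 1 / y ≤ 1 := by
      rw [div_le_one hy, hydef]; linarith
    have hpow : (1 + -(1 / y)) ^ r ≤ 1 - min 1 r * (1 / y) := by
      rcases le_total r 1 with h | h
      · have := rpow_one_add_le_one_add_mul_self (s := -(1 / y)) (by linarith) hr.le h
        rw [min_eq_right h]; linarith
      · have := Real.rpow_le_rpow_of_exponent_ge' (x := 1 + -(1 / y)) (by linarith)
          (by have : 0 ≤ 1 / y := by positivity
              linarith) zero_le_one h
        rw [Real.rpow_one] at this
        rw [min_eq_left h]; linarith
    have e : y ^ (-θ) = y ^ r * (1 / y) := by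
      rw [one_div, ← Real.rpow_neg_one, ← Real.rpow_add hy]; congr 1; rw [hrdef]; ring
    have h1 : ((n : ℝ) + s) ^ r + min 1 r * y ^ (-θ) ≤ y ^ r := by
      rw [hxy, Real.mul_rpow hy.le (by linarith), e]
      have := mul_le_mul_of_nonneg_left hpow (show 0 ≤ y ^ r by positivity)
      linarith
    have h2 : y ^ (-θ) ≤ 1 / min 1 r * (min 1 r * y ^ (-θ)) := by
      rw [← mul_assoc, one_div_mul_cancel hm.ne', one_mul]
    have h3 : 0 ≤ 1 / s * (min 1 r * y ^ (-θ)) := by positivity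
    have h4 := mul_le_mul_of_nonneg_left h1 (show 0 ≤ 1 / min 1 r + 1 / s by positivity)
    linarith

theorem powerSum_one_le {s : ℝ} (hs : 0 < s) :
    ∃ C, 0 ≤ C ∧ ∀ n : ℕ, 2 ≤ n → powerSum s 1 n ≤ C * Real.log n := by
  have h : ∀ n : ℕ, powerSum s 1 n ≤ 1 / s + Real.log (n + s) - Real.log s := fun n => by
    induction n with
    | zero => simp [powerSum, Real.rpow_neg_one]
    | succ n ih =>
      rw [powerSum, Finset.sum_range_succ]
      change powerSum s 1 n + _ ≤ _
      push_cast
      have hx : (0 : ℝ) < n + s := by positivity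
      have hy : (0 : ℝ) < n + 1 + s := by positivity
      have := Real.one_sub_inv_le_log_of_pos (show 0 < (n + 1 + s : ℝ) / (n + s) by positivity)
      rw [Real.log_div hy.ne' hx.ne'] at this
      have e : 1 - ((n + 1 + s : ℝ) / (n + s))⁻¹ = (n + 1 + s : ℝ) ^ (-1 : ℝ) := by
        rw [Real.rpow_neg_one]; field_simp; ring
      rw [e] at this
      linarith
  have hl2 : 0 < Real.log 2 := Real.log_pos (by norm_num)
  set c := |1 / s + Real.log (1 + s) - Real.log s|
  refine ⟨1 + c / Real.log 2, by positivity, fun n hn => ?_⟩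
  have hn' : (2 : ℝ) ≤ n := by exact_mod_cast hn
  have h1 : Real.log (n + s) ≤ Real.log n + Real.log (1 + s) := by
    rw [← Real.log_mul (by positivity) (by positivity)]
    exact Real.log_le_log (by positivity) (by nlinarith)
  have h2 : Real.log 2 ≤ Real.log n := Real.log_le_log (by norm_num) hn'
  have h3 : c ≤ c / Real.log 2 * Real.log n := by
    rw [div_mul_eq_mul_div, le_div_iff₀ hl2]
    exact mul_le_mul_of_nonneg_left h2 (abs_nonneg _)
  have := le_abs_self (1 / s + Real.log (1 + s) - Real.log s)
  linarith [h n]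

theorem powerSum_le_of_one_lt {s θ : ℝ} (hs : 0 < s) (hθ : 1 < θ) :
    ∃ C, 0 ≤ C ∧ ∀ n : ℕ, powerSum s θ n ≤ C := by
  have hsum : Summable fun j : ℕ => (j : ℝ) ^ (-θ) := Real.summable_nat_rpow.2 (by linarith)
  have hnn : ∀ j : ℕ, 0 ≤ (j : ℝ) ^ (-θ) := fun j => by positivity
  refine ⟨s ^ (-θ) + ∑' j : ℕ, (j : ℝ) ^ (-θ),
    add_nonneg (by positivity) (tsum_nonneg hnn), fun n => ?_⟩
  rw [powerSum, Finset.sum_range_succ', Nat.cast_zero, zero_add, add_comm]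
  gcongr
  refine le_trans ?_ (((summable_nat_add_iff 1).2 hsum).sum_le_tsum (Finset.range n)
    (fun j _ => hnn (j + 1)) |>.trans ?_)
  · refine Finset.sum_le_sum fun j _ => ?_
    exact Real.rpow_le_rpow_of_nonpos (by positivity) (by linarith) (by linarith)
  · rw [hsum.tsum_eq_zero_add]
    linarith [hnn 0]

/-- The constant depends on the upper bound `e` and not on `δ`, as needed for a `δ` that varies with
`n`. -/
theorem powerSum_add_le {s δ e : ℝ} (hs : 0 < s) (hδ : 0 ≤ δ) (he : δ ≤ e) (θ : ℝ) (n : ℕ) :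
    powerSum s (θ + δ) n ≤ min s 1 ^ (-e) * powerSum s θ n := by
  rw [powerSum, powerSum, Finset.mul_sum]
  refine Finset.sum_le_sum fun j _ => ?_
  have hm : 0 < min s 1 := lt_min hs one_pos
  have hj : min s 1 ≤ j + s := (min_le_left s 1).trans (by simp)
  rw [neg_add, Real.rpow_add (by positivity), mul_comm]
  gcongr
  calc ((j : ℝ) + s) ^ (-δ) ≤ min s 1 ^ (-δ) :=
        Real.rpow_le_rpow_of_nonpos hm hj (by linarith)
    _ ≤ min s 1 ^ (-e) :=
        Real.rpow_le_rpow_of_exponent_ge hm (min_le_right s 1) (by linarith)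

theorem rate_mul_sums_le {s C K E : ℝ} (hs : 0 < s) (hC : 0 ≤ C) (hK : 0 ≤ K) (hE : 0 ≤ E)
    (κ : ℝ) (n : ℕ) :
    rate s κ C n * (√(K * ∑ j ∈ Finset.range (n + 1), (rate s κ C j ^ 2)⁻¹) +
      E * ∑ j ∈ Finset.range n, (rate s κ C (j + 1) * √(j + 1))⁻¹) ≤
    Real.exp (C * (1 / s ^ 2 + 1 / s)) * (((n : ℝ) + s) ^ κ *
      (√(K * powerSum s (2 * κ) n) + E * √(1 + s) * powerSum s (κ + 1 / 2) n)) := by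
  have h1 : ∑ j ∈ Finset.range (n + 1), (rate s κ C j ^ 2)⁻¹ ≤ powerSum s (2 * κ) n := by
    refine Finset.sum_le_sum fun j _ => ?_
    have hj : (0 : ℝ) < j + s := by positivity
    have : ((j : ℝ) + s) ^ (-(2 * κ)) = ((((j : ℝ) + s) ^ κ) ^ 2)⁻¹ := by
      rw [Real.rpow_neg hj.le, ← Real.rpow_natCast, ← Real.rpow_mul hj.le]
      congr 2; push_cast; ring
    rw [this]
    have := le_rate hs hC κ j
    gcongr
  have h2 : ∑ j ∈ Finset.range n, (rate s κ C (j + 1) * √((j : ℝ) + 1))⁻¹ ≤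
      √(1 + s) * powerSum s (κ + 1 / 2) n := by
    rw [powerSum, Finset.sum_range_succ', mul_add, Finset.mul_sum]
    refine le_add_of_le_of_nonneg (Finset.sum_le_sum fun j _ => ?_) (by positivity)
    have hj : (0 : ℝ) < ((j + 1 : ℕ) : ℝ) + s := by positivity
    have e : (((j + 1 : ℕ) : ℝ) + s) ^ (-(κ + 1 / 2)) =
        ((((j + 1 : ℕ) : ℝ) + s) ^ κ * √(((j + 1 : ℕ) : ℝ) + s))⁻¹ := by
      rw [Real.rpow_neg hj.le, Real.sqrt_eq_rpow, ← Real.rpow_add hj]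
    -- The source of the factor `√(1 + s)`: it exchanges `√(j + 1)` for the square root of the
    -- shifted variable.
    have hsq : √(((j + 1 : ℕ) : ℝ) + s) ≤ √(1 + s) * √((j : ℝ) + 1) := by
      rw [← Real.sqrt_mul (by positivity)]
      refine Real.sqrt_le_sqrt ?_
      push_cast
      nlinarith [(Nat.cast_nonneg j : (0 : ℝ) ≤ j)]
    rw [e, ← div_eq_mul_inv, inv_eq_one_div, div_le_div_iff₀
      (mul_pos (rate_pos hs _ _ _) (by positivity)) (by positivity), one_mul]
    calc _ ≤ rate s κ C (j + 1) * (√(1 + s) * √((j : ℝ) + 1)) :=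
          mul_le_mul (le_rate hs hC κ (j + 1)) hsq (by positivity) (rate_pos hs _ _ _).le
      _ = _ := by ring
  have h3 : 0 ≤ ∑ j ∈ Finset.range n, (rate s κ C (j + 1) * √((j : ℝ) + 1))⁻¹ :=
    Finset.sum_nonneg fun j _ => by have := rate_pos hs κ C (j + 1); positivity
  calc _ ≤ (((n : ℝ) + s) ^ κ * Real.exp (C * (1 / s ^ 2 + 1 / s))) *
      (√(K * powerSum s (2 * κ) n) + E * (√(1 + s) * powerSum s (κ + 1 / 2) n)) := by
        gcongr
        exact rate_le hs hC κ n
    _ = _ := by ring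

/-- The growth rate in the `L^p` bounds, for an eigenvalue with real part `x`. -/
noncomputable def growth (b x : ℝ) (ν n : ℕ) : ℝ :=
  if x < b / 2 then (n : ℝ) ^ (1 / 2 : ℝ)
  else if x = b / 2 then (n : ℝ) ^ (1 / 2 : ℝ) * Real.log n ^ (ν + 1)
  else (n : ℝ) ^ (x / b) * Real.log n ^ ν

theorem exists_weight_of_lt {s b x K E : ℝ} (hs : 0 < s) (hb : 0 < b) (hK : 0 ≤ K) (hE : 0 ≤ E)
    (ν : ℕ) (hx : x < b / 2) :
    ∃ C, 0 ≤ C ∧ ∀ n : ℕ, 2 ≤ n → ∃ L : ℝ, 1 ≤ L ∧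
      L ^ ν * (((n : ℝ) + s) ^ (x / b + 1 / (L * b)) *
        (√(K * powerSum s (2 * (x / b + 1 / (L * b))) n) +
          E * powerSum s (x / b + 1 / (L * b) + 1 / 2) n)) ≤ C * (n : ℝ) ^ (1 / 2 : ℝ) := by
  have hg : 0 < 1 / 2 - x / b := by
    rw [sub_pos, div_lt_iff₀ hb]; linarith
  set g := 1 / 2 - x / b with hgdef
  -- Chosen so that the correction `1 / (L * b)` is smaller than the gap `g` to `1 / 2`.
  set L : ℝ := 1 + 2 / (g * b) with hL
  have hL1 : 1 ≤ L := by have : 0 < 2 / (g * b) := by positivity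
                         linarith
  set κ := x / b + 1 / (L * b) with hκ
  have hκ2 : κ < 1 / 2 := by
    have : 1 / (L * b) < g := by
      rw [div_lt_iff₀ (by positivity)]
      have : g * (L * b) = g * b + 2 := by rw [hL]; field_simp
      have : 0 < g * b := by positivity
      linarith
    rw [hκ]; linarith
  obtain ⟨C₁, hC₁, h₁⟩ := powerSum_le_of_lt_one (θ := 2 * κ) hs (by linarith)
  obtain ⟨C₂, hC₂, h₂⟩ := powerSum_le_of_lt_one (θ := κ + 1 / 2) hs (by linarith)
  refine ⟨L ^ ν * ((√(K * C₁) + E * C₂) * (1 + s) ^ (1 / 2 : ℝ)), by positivity,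
    fun n hn => ⟨L, hL1, ?_⟩⟩
  have hn' : (2 : ℝ) ≤ n := by exact_mod_cast hn
  have hns : (0 : ℝ) < n + s := by positivity
  have e1 : √(K * powerSum s (2 * κ) n) ≤ √(K * C₁) * ((n : ℝ) + s) ^ (1 / 2 - κ) := by
    have : (((n : ℝ) + s) ^ (1 - 2 * κ)) = (((n : ℝ) + s) ^ (1 / 2 - κ)) ^ 2 := by
      rw [← Real.rpow_natCast, ← Real.rpow_mul hns.le]; congr 1; push_cast; ring
    calc √(K * powerSum s (2 * κ) n) ≤ √(K * C₁ * (((n : ℝ) + s) ^ (1 / 2 - κ)) ^ 2) := by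
          rw [← this, mul_assoc]
          exact Real.sqrt_le_sqrt (mul_le_mul_of_nonneg_left (h₁ n) hK)
      _ = _ := by rw [Real.sqrt_mul (by positivity), Real.sqrt_sq (by positivity)]
  have e2 : powerSum s (κ + 1 / 2) n ≤ C₂ * ((n : ℝ) + s) ^ (1 / 2 - κ) := by
    refine (h₂ n).trans (le_of_eq ?_)
    congr 2; ring
  have e3 : ((n : ℝ) + s) ^ κ * ((n : ℝ) + s) ^ (1 / 2 - κ) = ((n : ℝ) + s) ^ (1 / 2 : ℝ) := by
    rw [← Real.rpow_add hns]; congr 1; ring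
  have e4 : ((n : ℝ) + s) ^ (1 / 2 : ℝ) ≤ (1 + s) ^ (1 / 2 : ℝ) * (n : ℝ) ^ (1 / 2 : ℝ) := by
    rw [← Real.mul_rpow (by positivity) (by positivity)]
    exact Real.rpow_le_rpow hns.le (by nlinarith) (by norm_num)
  calc _ ≤ L ^ ν * (((n : ℝ) + s) ^ κ * (√(K * C₁) * ((n : ℝ) + s) ^ (1 / 2 - κ) +
        E * (C₂ * ((n : ℝ) + s) ^ (1 / 2 - κ)))) := by gcongr
    _ = L ^ ν * ((√(K * C₁) + E * C₂) * ((n : ℝ) + s) ^ (1 / 2 : ℝ)) := by rw [← e3]; ring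
    _ ≤ L ^ ν * ((√(K * C₁) + E * C₂) * ((1 + s) ^ (1 / 2 : ℝ) * (n : ℝ) ^ (1 / 2 : ℝ))) := by
        gcongr
    _ = _ := by ring

/-- With the weight `log n / log 2` the exponent may be taken without its correction. -/
theorem log_weight_le {s b x K E : ℝ} (hs : 0 < s) (hb : 0 < b) (hK : 0 ≤ K) (hE : 0 ≤ E)
    (ν : ℕ) (hx : 0 ≤ x) :
    ∃ C D, 0 ≤ C ∧ 0 ≤ D ∧ ∀ n : ℕ, 2 ≤ n → ∃ L : ℝ, 1 ≤ L ∧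
      L ^ ν * (((n : ℝ) + s) ^ (x / b + 1 / (L * b)) *
        (√(K * powerSum s (2 * (x / b + 1 / (L * b))) n) +
          E * powerSum s (x / b + 1 / (L * b) + 1 / 2) n)) ≤
      C * ((n : ℝ) ^ (x / b) * Real.log n ^ ν) *
        (√(D * powerSum s (2 * (x / b)) n) + E * D * powerSum s (x / b + 1 / 2) n) := by
  have hl2 : 0 < Real.log 2 := Real.log_pos (by norm_num)
  have hm : 0 < min s 1 := lt_min hs one_pos
  -- The sums have their exponents shifted by at most `2 * δ ≤ 2 / b`.
  set D := min s 1 ^ (-(2 / b)) with hD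
  have hD0 : 0 ≤ D := by positivity
  set G := (1 + s) ^ (x / b) * ((1 + s) ^ (1 / b) * Real.exp (Real.log 2 / b)) with hG
  refine ⟨G / Real.log 2 ^ ν, (K + 1) * D, by positivity, by positivity, fun n hn =>
    ⟨Real.log n / Real.log 2, ?_, ?_⟩⟩
  · rw [one_le_div hl2]
    exact Real.log_le_log (by norm_num) (by exact_mod_cast hn)
  have hn' : (2 : ℝ) ≤ n := by exact_mod_cast hn
  have hn0 : (0 : ℝ) < n := by linarith
  have hns : (0 : ℝ) < n + s := by positivity
  have hl : Real.log 2 ≤ Real.log n := Real.log_le_log (by norm_num) hn'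
  have hl0 : 0 < Real.log n := hl2.trans_le hl
  have hnsle : (n : ℝ) + s ≤ (1 + s) * n := by nlinarith
  set δ := 1 / (Real.log n / Real.log 2 * b) with hδ
  -- Consequently `n ^ δ = exp (log 2 / b)` does not depend on `n`.
  have hδ' : δ = Real.log 2 / (Real.log n * b) := by rw [hδ]; field_simp
  have hδ0 : 0 ≤ δ := by positivity
  have hδb : δ ≤ 1 / b := by
    rw [hδ', div_le_div_iff₀ (by positivity) hb]
    nlinarith
  have e1 : ((n : ℝ) + s) ^ (x / b + δ) ≤ G * (n : ℝ) ^ (x / b) := by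
    have f1 : ((n : ℝ) + s) ^ (x / b) ≤ (1 + s) ^ (x / b) * (n : ℝ) ^ (x / b) := by
      rw [← Real.mul_rpow (by positivity) (by positivity)]
      exact Real.rpow_le_rpow hns.le hnsle (by positivity)
    have f2 : ((n : ℝ) + s) ^ δ ≤ (1 + s) ^ (1 / b) * Real.exp (Real.log 2 / b) := by
      calc ((n : ℝ) + s) ^ δ ≤ ((1 + s) * n) ^ δ := Real.rpow_le_rpow hns.le hnsle hδ0
        _ = (1 + s) ^ δ * (n : ℝ) ^ δ := Real.mul_rpow (by positivity) (by positivity)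
        _ ≤ _ := by
          gcongr
          · linarith
          · rw [Real.rpow_def_of_pos hn0, Real.exp_le_exp, hδ']
            refine le_of_eq ?_
            field_simp
    rw [Real.rpow_add hns]
    calc _ ≤ ((1 + s) ^ (x / b) * (n : ℝ) ^ (x / b)) *
          ((1 + s) ^ (1 / b) * Real.exp (Real.log 2 / b)) := by gcongr
      _ = _ := by rw [hG]; ring
  have hp1 := powerSum_nonneg hs (2 * (x / b)) n
  have hp2 := powerSum_nonneg hs (x / b + 1 / 2) n
  have hp3 := powerSum_nonneg hs (x / b + δ + 1 / 2) n
  have e2 : K * powerSum s (2 * (x / b + δ)) n ≤ (K + 1) * D * powerSum s (2 * (x / b)) n := by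
    have := powerSum_add_le hs (δ := 2 * δ) (e := 2 / b) (by positivity)
      (by rw [← mul_one_div]; linarith) (2 * (x / b)) n
    rw [← mul_add] at this
    calc _ ≤ K * (D * powerSum s (2 * (x / b)) n) := by gcongr
      _ ≤ _ := by
        have : 0 ≤ D * powerSum s (2 * (x / b)) n := by positivity
        nlinarith
  have e3 : powerSum s (x / b + δ + 1 / 2) n ≤ (K + 1) * D * powerSum s (x / b + 1 / 2) n := by
    have := powerSum_add_le hs (δ := δ) (e := 2 / b) hδ0
      (hδb.trans (by gcongr; norm_num)) (x / b + 1 / 2) n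
    rw [add_right_comm]
    refine this.trans ?_
    have : 0 ≤ K * (D * powerSum s (x / b + 1 / 2) n) := by positivity
    linarith
  calc _ ≤ (Real.log n / Real.log 2) ^ ν * (G * (n : ℝ) ^ (x / b) *
        (√((K + 1) * D * powerSum s (2 * (x / b)) n) +
          E * ((K + 1) * D * powerSum s (x / b + 1 / 2) n))) := by gcongr
    _ = _ := by rw [div_pow]; ring

/-- At `x = b / 2` both sums have exponent `1` and are of order `log n`. The noise sum stands under
a square root, so it is the error sum that produces the extra logarithm. -/
theorem exists_weight {s b K E : ℝ} (hs : 0 < s) (hb : 0 < b) (hK : 0 ≤ K) (hE : 0 ≤ E)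
    (x : ℝ) (ν : ℕ) :
    ∃ C, 0 ≤ C ∧ ∀ n : ℕ, 2 ≤ n → ∃ L : ℝ, 1 ≤ L ∧
      L ^ ν * (((n : ℝ) + s) ^ (x / b + 1 / (L * b)) *
        (√(K * powerSum s (2 * (x / b + 1 / (L * b))) n) +
          E * powerSum s (x / b + 1 / (L * b) + 1 / 2) n)) ≤ C * growth b x ν n := by
  have hl2 : 0 < Real.log 2 := Real.log_pos (by norm_num)
  rcases lt_trichotomy x (b / 2) with hx | hx | hx
  · simp only [growth, if_pos hx]
    exact exists_weight_of_lt hs hb hK hE ν hx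
  · have hxb : x / b = 1 / 2 := by rw [hx]; field_simp
    obtain ⟨C, D, hC, hD, h⟩ := log_weight_le hs hb hK hE ν (x := x) (by rw [hx]; positivity)
    obtain ⟨C₁, hC₁, h₁⟩ := powerSum_one_le hs
    refine ⟨C * (D * C₁ + 1 / Real.log 2 + E * D * C₁), by positivity, fun n hn => ?_⟩
    obtain ⟨L, hL, hLn⟩ := h n hn
    refine ⟨L, hL, hLn.trans ?_⟩
    have hl : Real.log 2 ≤ Real.log n := Real.log_le_log (by norm_num) (by exact_mod_cast hn)
    have hl0 : 0 < Real.log n := hl2.trans_le hl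
    have h1n := h₁ n hn
    have hsq : √(D * powerSum s 1 n) ≤ (D * C₁ + 1 / Real.log 2) * Real.log n := by
      have f1 : √(D * powerSum s 1 n) ≤ √(D * C₁ * Real.log n) := by
        rw [mul_assoc]
        exact Real.sqrt_le_sqrt (mul_le_mul_of_nonneg_left h1n hD)
      have f2 : √(D * C₁ * Real.log n) ≤ D * C₁ * Real.log n + 1 := by
        rw [Real.sqrt_le_left (by positivity)]
        have : 0 ≤ D * C₁ * Real.log n := by positivity
        nlinarith
      have f3 : 1 ≤ 1 / Real.log 2 * Real.log n := by
        rw [one_div_mul_eq_div, one_le_div hl2]; exact hl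
      linarith
    simp only [growth, hx, lt_irrefl, if_false, if_true]
    rw [hx] at hxb
    rw [hxb, show (2 : ℝ) * (1 / 2) = 1 by norm_num, show (1 / 2 + 1 / 2 : ℝ) = 1 by norm_num]
    calc _ ≤ C * ((n : ℝ) ^ (1 / 2 : ℝ) * Real.log n ^ ν) *
          ((D * C₁ + 1 / Real.log 2) * Real.log n + E * D * (C₁ * Real.log n)) := by gcongr
      _ = _ := by ring
  · have hxb : 1 / 2 < x / b := by rw [lt_div_iff₀ hb]; linarith
    obtain ⟨C, D, hC, hD, h⟩ := log_weight_le hs hb hK hE ν (x := x) (by linarith)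
    obtain ⟨C₁, hC₁, h₁⟩ := powerSum_le_of_one_lt (θ := 2 * (x / b)) hs (by linarith)
    obtain ⟨C₂, hC₂, h₂⟩ := powerSum_le_of_one_lt (θ := x / b + 1 / 2) hs (by linarith)
    refine ⟨C * (√(D * C₁) + E * D * C₂), by positivity, fun n hn => ?_⟩
    obtain ⟨L, hL, hLn⟩ := h n hn
    refine ⟨L, hL, hLn.trans ?_⟩
    have h1 := h₁ n
    have h2 := h₂ n
    have hl0 : 0 ≤ Real.log n := Real.log_natCast_nonneg n
    simp only [growth, hx.not_gt, hx.ne', if_false]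
    calc _ ≤ C * ((n : ℝ) ^ (x / b) * Real.log n ^ ν) * (√(D * C₁) + E * D * C₂) := by gcongr
      _ = _ := by ring

end Rates

/-! ### The bound for a spectral projection and the change of centring. -/

namespace PolyaUrn

variable {q : ℕ}

theorem scale_eq (U : PolyaUrn q) {b : ℝ} (hb : 0 < b) (k : ℕ) :
    U.scale b k = b * (k + U.activity U.x₀ / b) := by
  unfold scale; field_simp; ring

/-- The `L^p` bound for a spectral projection of the urn, centred at the mean evolution. -/
theorem Cond.exists_bound {U : PolyaUrn q} {b p : ℝ} (hU : U.Cond b p) (hp : 2 ≤ p) (z : ℂ) :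
    ∃ C, 0 ≤ C ∧ ∀ (Ω : Type u) [MeasurableSpace Ω] (μ : Measure Ω) [IsProbabilityMeasure μ]
      (X : ℕ → Ω → EuclideanSpace ℝ (Fin q)), U.IsRealization μ X → ∀ n : ℕ, 2 ≤ n →
        eLpNorm ((U.nonExtinct X n).indicator fun ω =>
          spectralProj U.op z (toComplexVec (X n ω - U.meanPath b n))) (ENNReal.ofReal p) μ ≤
        ENNReal.ofReal (C * growth b z.re (jordanNu U.op z) n) := by
  have hb := hU.balanced.1
  have hS : 0 < U.activity U.x₀ := U.x₀_active
  set s := U.activity U.x₀ / b with hs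
  have hs0 : 0 < s := by positivity
  have hK := U.noiseConst_pos hp
  have hE := U.errConst_nonneg (p := p) hb
  set ν := jordanNu U.op z with hν
  obtain ⟨R, hR, hQR⟩ := exists_norm_resolve_le U.op z ν
  obtain ⟨C₁, hC₁, hw⟩ := exists_weight (E := U.errConst b p * √(1 + s)) hs0 hb hK.le
    (by positivity) z.re ν
  set D := ‖z‖ ^ 2 / (2 * b ^ 2) with hD
  -- Dominates `|κ| + D` for every `L ≥ 1`, so the constant does not depend on `n`.
  set C₀ := |z.re| / b + 1 / b + D with hC₀
  have hC₀0 : 0 ≤ C₀ := by positivity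
  refine ⟨R * Real.exp (C₀ * (1 / s ^ 2 + 1 / s)) * C₁, by positivity,
    fun Ω _ μ _ X hX n hn => ?_⟩
  obtain ⟨L, hL, hLn⟩ := hw n hn
  have hL0 : 0 < L := by linarith
  set κ := z.re / b + 1 / (L * b) with hκ
  have hκC : |κ| + D ≤ C₀ := by
    have h1 : |1 / (L * b)| ≤ 1 / b := by
      rw [abs_of_nonneg (by positivity)]
      exact one_div_le_one_div_of_le hb (by nlinarith)
    have h2 : |z.re / b| = |z.re| / b := by rw [abs_div, abs_of_pos hb]
    have := abs_add_le (z.re / b) (1 / (L * b))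
    rw [hκ, hC₀]; linarith
  have hstep : ∀ k x, ‖resolve U.op z L (ν + 1) (U.stepMap b k x)‖ ≤
      rate s κ C₀ (k + 1) / rate s κ C₀ k * ‖resolve U.op z L (ν + 1) x‖ := fun k x => by
    refine (hU.norm_resolve_stepMap_le hp z hL0 k x).trans
      (mul_le_mul_of_nonneg_right ?_ (norm_nonneg _))
    refine le_trans (le_of_eq ?_) (exp_le_rate_ratio hs0 hκC k)
    have : 0 < (k : ℝ) + s := by positivity
    rw [U.scale_eq hb, ← hs, hκ, hD]
    congr 1
    field_simp
    ring
  have hmain := hX.eLpNorm_sub_meanPath_le hU hp (resolve U.op z L (ν + 1))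
    (R := R * L ^ ν) (by positivity) (hQR L hL) (rate_pos hs0 κ C₀) hstep n
  refine le_trans (eLpNorm_mono fun ω => ?_) (hmain.trans (ENNReal.ofReal_le_ofReal ?_))
  · by_cases hω : ω ∈ U.nonExtinct X n
    · rw [Set.indicator_of_mem hω, Set.indicator_of_mem hω]
      exact norm_spectralProj_le_resolve U.op z L ν _
    · rw [Set.indicator_of_notMem hω, Set.indicator_of_notMem hω, norm_zero, norm_zero]
  · have h := rate_mul_sums_le hs0 hC₀0 hK.le hE κ n
    calc _ = R * L ^ ν * (rate s κ C₀ n *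
          (√(U.noiseConst p * ∑ j ∈ Finset.range (n + 1), (rate s κ C₀ j ^ 2)⁻¹) +
            U.errConst b p *
              ∑ j ∈ Finset.range n, (rate s κ C₀ (j + 1) * √((j : ℝ) + 1))⁻¹)) := by ring
      _ ≤ _ := mul_le_mul_of_nonneg_left h (by positivity)
      _ = R * Real.exp (C₀ * (1 / s ^ 2 + 1 / s)) * (L ^ ν * (((n : ℝ) + s) ^ κ *
            (√(U.noiseConst p * powerSum s (2 * κ) n) +
              U.errConst b p * √(1 + s) * powerSum s (κ + 1 / 2) n))) := by ring
      _ ≤ _ := by rw [mul_assoc (R * _) C₁]; gcongr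

/-- The factor lost on replacing a deterministic centring with the conditional mean. -/
noncomputable def centerConst (U : PolyaUrn q) (b : ℝ) : ℝ :=
  1 + (U.activity U.x₀ + U.survConst b) / U.activity U.x₀

theorem centerConst_pos (U : PolyaUrn q) {b : ℝ} (hb : 0 < b) : 0 < U.centerConst b := by
  have hS : 0 < U.activity U.x₀ := U.x₀_active
  have := U.survConst_pos hb
  unfold centerConst; positivity

namespace IsRealization

variable {U : PolyaUrn q} {Ω : Type*} [MeasurableSpace Ω] {μ : Measure Ω}
  [IsProbabilityMeasure μ] {X : ℕ → Ω → EuclideanSpace ℝ (Fin q)} {b p : ℝ}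

theorem measure_nonExtinct_pos (hX : U.IsRealization μ X) (hU : U.Cond b p) (hp : 2 ≤ p)
    (n : ℕ) : 0 < μ (U.nonExtinct X n) := by
  have hS : 0 < U.activity U.x₀ := U.x₀_active
  have hK := U.survConst_pos hU.balanced.1
  have h := hX.survival hU hp n
  have : 0 < μ.real (U.nonExtinct X n) := lt_of_lt_of_le (by positivity) h
  exact pos_iff_ne_zero.2 fun h0 => this.ne' (by simp [Measure.real, h0])

theorem integrable_cond (hX : U.IsRealization μ X) (hU : U.Cond b p) (hp : 2 ≤ p) (n : ℕ) :
    Integrable (X n) (μ[|U.nonExtinct X n]) :=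
  (hX.integrable hU hp n).restrict.smul_measure
    (ENNReal.inv_ne_top.2 (hX.measure_nonExtinct_pos hU hp n).ne')

/-- Any deterministic centring `v` will do: the distance from `v` to the conditional mean, after
applying `Q`, is at most the `L¹` norm on non-extinction divided by the survival probability. -/
theorem eLpNorm_sub_condMean_le (hX : U.IsRealization μ X) (hU : U.Cond b p) (hp : 2 ≤ p) (n : ℕ)
    {F : Type*} [NormedAddCommGroup F] [NormedSpace ℝ F] [CompleteSpace F]
    (Q : EuclideanSpace ℝ (Fin q) →L[ℝ] F) (v : EuclideanSpace ℝ (Fin q)) {B : ℝ} (hB : 0 ≤ B)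
    (h : eLpNorm ((U.nonExtinct X n).indicator fun ω => Q (X n ω - v)) (ENNReal.ofReal p) μ ≤
      ENNReal.ofReal B) :
    eLpNorm ((U.nonExtinct X n).indicator fun ω =>
      Q (X n ω - ∫ ω', X n ω' ∂(μ[|U.nonExtinct X n]))) (ENNReal.ofReal p) μ ≤
      ENNReal.ofReal (U.centerConst b * B) := by
  have hS : 0 < U.activity U.x₀ := U.x₀_active
  have hK := U.survConst_pos hU.balanced.1
  have hpp : 1 ≤ ENNReal.ofReal p := by
    rw [← ENNReal.ofReal_one]; exact ENNReal.ofReal_le_ofReal (by linarith)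
  set A := U.nonExtinct X n with hA
  have hAm : MeasurableSet A := hX.past_le n _ (U.measurableSet_nonExtinct X le_rfl)
  have hA0 : 0 < μ A := hX.measure_nonExtinct_pos hU hp n
  have hprob : IsProbabilityMeasure (μ[|A]) := cond_isProbabilityMeasure hA0.ne'
  have hi := hX.integrable_cond hU hp n
  set m := ∫ ω', X n ω' ∂(μ[|A]) with hm
  have hmeas : Measurable fun ω => X n ω - v := (hX.measurable n).sub measurable_const
  have hQm : AEStronglyMeasurable (A.indicator fun ω => Q (X n ω - v)) μ :=
    (Q.continuous.comp_aestronglyMeasurable hmeas.aestronglyMeasurable).indicator hAm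
  have h1 : eLpNorm (A.indicator fun ω => Q (X n ω - v)) 1 μ ≤ ENNReal.ofReal B :=
    (eLpNorm_le_eLpNorm_of_exponent_le hpp hQm).trans h
  have hmean : ‖Q (m - v)‖ₑ ≤ (μ A)⁻¹ * ENNReal.ofReal B := by
    have hi' : Integrable (fun ω => X n ω - v) (μ[|A]) := hi.sub (integrable_const v)
    have e : Q (m - v) = ∫ ω, Q (X n ω - v) ∂(μ[|A]) := by
      rw [Q.integral_comp_comm hi',
        integral_sub hi (integrable_const v), integral_const, probReal_univ, one_smul]
    rw [e]
    refine (enorm_integral_le_lintegral_enorm _).trans ?_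
    rw [ProbabilityTheory.cond, lintegral_smul_measure, smul_eq_mul,
      ← lintegral_indicator hAm]
    refine mul_le_mul_right (le_trans (le_of_eq ?_) h1) _
    rw [eLpNorm_one_eq_lintegral_enorm]
    refine lintegral_congr fun ω => ?_
    rw [enorm_indicator_eq_indicator_enorm]
  have hinv : (μ A)⁻¹ ≤ ENNReal.ofReal ((U.activity U.x₀ + U.survConst b) / U.activity U.x₀) := by
    have h2 := hX.survival hU hp n
    rw [← ENNReal.inv_le_inv, inv_inv, ← ENNReal.ofReal_inv_of_pos (by positivity), inv_div]
    exact (ENNReal.ofReal_le_iff_le_toReal (measure_ne_top _ _)).2 h2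
  have e : (A.indicator fun ω => Q (X n ω - m)) =
      (A.indicator fun ω => Q (X n ω - v)) - A.indicator fun _ => Q (m - v) := by
    ext ω
    by_cases hω : ω ∈ A
    · simp [hω]
    · simp [hω]
  rw [e]
  refine (eLpNorm_sub_le hQm (aestronglyMeasurable_const.indicator hAm) hpp).trans ?_
  have h3 : eLpNorm (A.indicator fun _ => Q (m - v)) (ENNReal.ofReal p) μ ≤ ‖Q (m - v)‖ₑ := by
    refine (eLpNorm_indicator_le _).trans ?_
    rw [eLpNorm_const _ (by positivity) (NeZero.ne _), measure_univ, ENNReal.one_rpow, mul_one]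
  refine (add_le_add h (h3.trans (hmean.trans (mul_le_mul_left hinv _)))).trans (le_of_eq ?_)
  rw [← ENNReal.ofReal_mul (by positivity), ← ENNReal.ofReal_add hB (by positivity), centerConst]
  congr 1; ring

end IsRealization

/-! ### The leading eigenvalue. -/

/-- The activity as a functional on complex vectors. -/
noncomputable def complexActivity (U : PolyaUrn q) : EuclideanSpace ℂ (Fin q) →ₗ[ℂ] ℂ where
  toFun v := ∑ i, (U.a i : ℂ) * v i
  map_add' x y := by simp [mul_add, Finset.sum_add_distrib]
  map_smul' c x := by
    simp only [PiLp.smul_apply, smul_eq_mul, RingHom.id_apply, Finset.mul_sum]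
    exact Finset.sum_congr rfl fun i _ => by ring

theorem complexActivity_apply (U : PolyaUrn q) (v : EuclideanSpace ℂ (Fin q)) :
    U.complexActivity v = ∑ i, (U.a i : ℂ) * v i := rfl

theorem complexActivity_toComplexVec (U : PolyaUrn q) (x : EuclideanSpace ℝ (Fin q)) :
    U.complexActivity (toComplexVec x) = (U.activity x : ℂ) := by
  simp [complexActivity_apply, toComplexVec, activity]

namespace Cond

variable {U : PolyaUrn q} {b p : ℝ}

theorem complexActivity_op (hU : U.Cond b p) (v : EuclideanSpace ℂ (Fin q)) :
    U.complexActivity (U.op v) = b * U.complexActivity v := by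
  simp only [complexActivity_apply, op, Matrix.toLpLin_apply, Matrix.mulVec, dotProduct,
    intensity, Matrix.of_apply, Finset.mul_sum]
  rw [Finset.sum_comm]
  refine Finset.sum_congr rfl fun j _ => ?_
  rcases (U.a_nonneg j).eq_or_lt with h | h
  · simp [← h]
  · have hj := hU.balanced.2 j h
    have hj' : (b : ℂ) = ∑ i, (U.a i : ℂ) * ((∫ y, y i ∂(U.ξ j) : ℝ) : ℂ) := by
      rw [← hj]; push_cast; rfl
    rw [hj', Finset.sum_mul]
    refine Finset.sum_congr rfl fun i _ => ?_
    push_cast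
    ring

/-- A left eigenvector for `b` turns `(A - w) ^ k` into the nonzero scalar `(b - w) ^ k`. -/
theorem complexActivity_eq_zero (hU : U.Cond b p) {w : ℂ} (hw : w ≠ b)
    {x : EuclideanSpace ℂ (Fin q)} (hx : x ∈ U.op.maxGenEigenspace w) :
    U.complexActivity x = 0 := by
  rw [Module.End.mem_maxGenEigenspace] at hx
  obtain ⟨k, hk⟩ := hx
  have h : ∀ (k : ℕ) (x : EuclideanSpace ℂ (Fin q)), U.complexActivity
      (((U.op - w • (1 : Module.End ℂ (EuclideanSpace ℂ (Fin q)))) ^ k) x) =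
      ((b : ℂ) - w) ^ k * U.complexActivity x := fun k => by
    induction k with
    | zero => simp
    | succ k ih =>
      intro x
      rw [pow_succ, Module.End.mul_apply, ih]
      simp only [LinearMap.sub_apply, LinearMap.smul_apply, Module.End.one_apply, map_sub,
        map_smul, hU.complexActivity_op, smul_eq_mul]
      ring
  have h1 := h k x
  rw [hk, map_zero] at h1
  exact (mul_eq_zero.1 h1.symm).resolve_left (pow_ne_zero _ (sub_ne_zero.2 hw.symm))

theorem complexActivity_spectralProj (hU : U.Cond b p) (x : EuclideanSpace ℂ (Fin q)) :
    U.complexActivity (spectralProj U.op b x) = U.complexActivity x := by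
  have h : (⨆ (w : ℂ) (_ : w ≠ b), U.op.maxGenEigenspace w) ≤ LinearMap.ker U.complexActivity :=
    iSup₂_le fun w hw x hx => LinearMap.mem_ker.2 (hU.complexActivity_eq_zero hw hx)
  have := LinearMap.mem_ker.1 (h (sub_spectralProj_mem U.op b x))
  rw [map_sub, sub_eq_zero] at this
  exact this.symm

/-- Simplicity makes the generalized eigenspace a line. The activity does not vanish on it, as the
projection of `x₀` has activity `a·x₀ > 0`, so it serves as a coordinate. -/
theorem exists_leading_eigenvector (hU : U.Cond b p)
    (h1 : U.intensity.charpoly.rootMultiplicity (b : ℂ) = 1) :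
    ∃ v₁ : EuclideanSpace ℂ (Fin q), U.op v₁ = (b : ℂ) • v₁ ∧ U.complexActivity v₁ = 1 ∧
      ∀ x, spectralProj U.op b x = U.complexActivity x • v₁ := by
  have hS : 0 < U.activity U.x₀ := U.x₀_active
  have hchar : U.op.charpoly = U.intensity.charpoly := by
    change (Matrix.toLpLin 2 2 U.intensity).charpoly = _
    rw [Matrix.toLpLin_eq_toLin, Matrix.charpoly_toLin]
  have hfin : Module.finrank ℂ (U.op.maxGenEigenspace (b : ℂ)) = 1 := by
    rw [LinearMap.finrank_maxGenEigenspace_eq, hchar, h1]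
  obtain ⟨v, -, hv⟩ := finrank_eq_one_iff'.1 hfin
  have hspan : ∀ x ∈ U.op.maxGenEigenspace (b : ℂ), ∃ c : ℂ, c • (v : EuclideanSpace ℂ (Fin q)) = x :=
    fun x hx => by
      obtain ⟨c, hc⟩ := hv ⟨x, hx⟩
      exact ⟨c, congrArg Subtype.val hc⟩
  have hα : U.complexActivity v ≠ 0 := fun h0 => by
    obtain ⟨c, hc⟩ := hspan _ (spectralProj_mem U.op b (toComplexVec U.x₀))
    have := hU.complexActivity_spectralProj (toComplexVec U.x₀)
    rw [← hc, map_smul, h0, smul_zero, complexActivity_toComplexVec] at this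
    exact hS.ne (by exact_mod_cast this)
  set v₁ : EuclideanSpace ℂ (Fin q) := (U.complexActivity v)⁻¹ • (v : EuclideanSpace ℂ (Fin q))
    with hv₁
  have hα1 : U.complexActivity v₁ = 1 := by
    rw [hv₁, map_smul, smul_eq_mul, inv_mul_cancel₀ hα]
  have hrep : ∀ x ∈ U.op.maxGenEigenspace (b : ℂ), x = U.complexActivity x • v₁ := fun x hx => by
    obtain ⟨c, rfl⟩ := hspan x hx
    rw [hv₁, map_smul, smul_smul, smul_eq_mul, mul_inv_cancel_right₀ hα]
  have hmem : v₁ ∈ U.op.maxGenEigenspace (b : ℂ) := Submodule.smul_mem _ _ v.2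
  refine ⟨v₁, ?_, hα1, fun x => ?_⟩
  · have := hrep _ (Module.End.mapsTo_maxGenEigenspace_of_comm (Commute.refl U.op) b hmem)
    rwa [hU.complexActivity_op, hα1, mul_one] at this
  · have := hrep _ (spectralProj_mem U.op b x)
    rwa [hU.complexActivity_spectralProj] at this

end Cond

end PolyaUrn

/-! ### Assembly of the theorem. -/

theorem mainTheorem3 {q : ℕ} (hq : 2 ≤ q) (U : PolyaUrn q) (b p : ℝ) (hp : 2 ≤ p)
    (hU : U.Cond b p) :
    -- the conditional expectations are well defined
    (∀ (Ω : Type u) [MeasurableSpace Ω] (μ : Measure Ω) [IsProbabilityMeasure μ]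
        (X : ℕ → Ω → EuclideanSpace ℝ (Fin q)), U.IsRealization μ X →
      ∀ n, 0 < μ (U.nonExtinct X n) ∧ Integrable (X n) μ) ∧
    -- part (i)
    (∃ C : ℝ, ∀ (Ω : Type u) [MeasurableSpace Ω] (μ : Measure Ω) [IsProbabilityMeasure μ]
        (X : ℕ → Ω → EuclideanSpace ℝ (Fin q)), U.IsRealization μ X →
      ∀ z ∈ spectrum ℂ U.intensity, ∀ n : ℕ, 2 ≤ n →
        eLpNorm ((U.nonExtinct X n).indicator
            fun ω => spectralProj U.op z (U.centered μ X n ω)) (ENNReal.ofReal p) μ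
          ≤ ENNReal.ofReal (C *
              (if z.re < b / 2 then (n : ℝ) ^ (1 / 2 : ℝ)
              else if z.re = b / 2 then
                (n : ℝ) ^ (1 / 2 : ℝ) * Real.log n ^ (jordanNu U.op z + 1)
              else (n : ℝ) ^ (z.re / b) * Real.log n ^ jordanNu U.op z))) ∧
    -- part (ii)
    (U.intensity.charpoly.rootMultiplicity (b : ℂ) = 1 →
      ∃ v₁ : EuclideanSpace ℂ (Fin q),
        (∀ v : EuclideanSpace ℂ (Fin q),
          (U.op v = (b : ℂ) • v ∧ ∑ i, (U.a i : ℂ) * v i = 1) ↔ v = v₁) ∧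
        ∃ C : ℝ, ∀ (Ω : Type u) [MeasurableSpace Ω] (μ : Measure Ω) [IsProbabilityMeasure μ]
            (X : ℕ → Ω → EuclideanSpace ℝ (Fin q)), U.IsRealization μ X →
          ∀ n : ℕ,
            (∀ ω, spectralProj U.op b (U.centered μ X n ω) =
              ((U.activity (X n ω) -
                ∫ ω', U.activity (X n ω') ∂(μ[|U.nonExtinct X n]) : ℝ) : ℂ) • v₁) ∧
            eLpNorm ((U.nonExtinct X n).indicator
                fun ω => spectralProj U.op b (U.centered μ X n ω)) (ENNReal.ofReal p) μ
              ≤ ENNReal.ofReal (C * √(n : ℝ))) := by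
  have hb := hU.balanced.1
  have hS : 0 < U.activity U.x₀ := U.x₀_active
  have hcc := U.centerConst_pos hb
  refine ⟨fun Ω _ μ _ X hX n => ⟨hX.measure_nonExtinct_pos hU hp n, hX.integrable hU hp n⟩,
    ?_, fun h1 => ?_⟩
  · have hfin : (spectrum ℂ U.intensity).Finite := Matrix.finite_spectrum _
    choose C hC hbound using fun z => hU.exists_bound.{u} hp z
    -- Summing over the finite spectrum makes the constant independent of the eigenvalue.
    refine ⟨U.centerConst b * ∑ z ∈ hfin.toFinset, C z, fun Ω _ μ _ X hX z hz n hn => ?_⟩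
    have hgrow : 0 ≤ growth b z.re (jordanNu U.op z) n := by
      have := Real.log_natCast_nonneg n
      unfold growth; split_ifs <;> positivity
    have h := hX.eLpNorm_sub_condMean_le hU hp n
      ((realCLM (spectralProj U.op z)).comp (toComplexCLM q)) (U.meanPath b n)
      (mul_nonneg (hC z) hgrow) (hbound z Ω μ X hX n hn)
    refine h.trans (ENNReal.ofReal_le_ofReal ?_)
    change _ ≤ _ * growth b z.re (jordanNu U.op z) n
    rw [← mul_assoc]
    gcongr
    exact Finset.single_le_sum (f := C) (fun z _ => hC z) (hfin.mem_toFinset.2 hz)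
  · obtain ⟨v₁, hv, hα, hP⟩ := hU.exists_leading_eigenvector h1
    refine ⟨v₁, fun v => ⟨fun ⟨h2, h3⟩ => ?_, ?_⟩, ?_⟩
    · have hmem : v ∈ U.op.maxGenEigenspace (b : ℂ) := by
        rw [Module.End.mem_maxGenEigenspace]
        exact ⟨1, by simp [h2]⟩
      rw [← spectralProj_apply_of_mem U.op hmem, hP, PolyaUrn.complexActivity_apply, h3, one_smul]
    · rintro rfl
      exact ⟨hv, hα⟩
    have hid : ∀ x : EuclideanSpace ℝ (Fin q),
        spectralProj U.op b (toComplexVec x) = (U.activity x : ℂ) • v₁ := fun x => by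
      rw [hP, U.complexActivity_toComplexVec]
    set c := U.noiseConst p * (‖U.activityCLM‖ + 1) ^ 2 with hc
    have hc0 : 0 ≤ c := by have := U.noiseConst_pos hp; positivity
    refine ⟨U.centerConst b * (‖v₁‖ * √(2 * c)), fun Ω _ μ _ X hX n => ⟨fun ω => ?_, ?_⟩⟩
    · rw [PolyaUrn.centered, hid, U.activity_sub]
      have := U.activityCLM.integral_comp_comm (hX.integrable_cond hU hp n)
      simp only [PolyaUrn.activityCLM_apply] at this
      rw [this]
    · rcases Nat.eq_zero_or_pos n with rfl | hn
      -- At `n = 0` the bound is `0`, and the centred vector vanishes almost surely because the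
      -- start is deterministic.
      · have hprob : IsProbabilityMeasure (μ[|U.nonExtinct X 0]) :=
          cond_isProbabilityMeasure (hX.measure_nonExtinct_pos hU hp 0).ne'
        have hmean : ∫ ω', X 0 ω' ∂(μ[|U.nonExtinct X 0]) = U.x₀ := by
          rw [integral_congr_ae (cond_absolutelyContinuous.ae_le hX.init)]
          simp
        have hz : (U.nonExtinct X 0).indicator
            (fun ω => spectralProj U.op b (U.centered μ X 0 ω)) =ᵐ[μ] 0 := by
          filter_upwards [hX.init] with ω hω
          have : U.centered μ X 0 ω = 0 := by
            rw [PolyaUrn.centered, hmean, hω, sub_self]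
            exact (toComplexCLM q).map_zero
          simp [Set.indicator, this]
        rw [eLpNorm_congr_ae hz]
        simp
      · have hn1 : (1 : ℝ) ≤ n := by exact_mod_cast hn
        -- The multiple of `x₀` with activity `scale b n` serves as centring, since only its
        -- activity survives the projection. The factor 2 in `√(2 * c)` absorbs `n + 1 ≤ 2 n`.
        have hB : eLpNorm ((U.nonExtinct X n).indicator fun ω =>
            (realCLM (spectralProj U.op b)).comp (toComplexCLM q)
              (X n ω - (U.scale b n / U.activity U.x₀) • U.x₀)) (ENNReal.ofReal p) μ ≤
            ENNReal.ofReal (‖v₁‖ * √(2 * c) * √(n : ℝ)) := by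
          refine (eLpNorm_le_mul_eLpNorm_of_ae_le_mul (c := ‖v₁‖)
            (g := (U.nonExtinct X n).indicator fun ω => U.activity (X n ω) - U.scale b n)
            (ae_of_all _ fun ω => ?_) _).trans ((mul_le_mul_right
              (hX.eLpNorm_activity_sub_scale_le hU hp n) _).trans ?_)
          · by_cases hω : ω ∈ U.nonExtinct X n
            · rw [Set.indicator_of_mem hω, Set.indicator_of_mem hω]
              simp only [ContinuousLinearMap.comp_apply, toComplexCLM_apply, realCLM_apply, hid,
                U.activity_sub, U.activity_smul, div_mul_cancel₀ _ hS.ne', norm_smul,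
                Complex.norm_real]
              rw [mul_comm]
            · rw [Set.indicator_of_notMem hω, norm_zero]; positivity
          · rw [← ENNReal.ofReal_mul (norm_nonneg _), mul_assoc ‖v₁‖,
              ← Real.sqrt_mul (by positivity)]
            refine ENNReal.ofReal_le_ofReal (mul_le_mul_of_nonneg_left
              (Real.sqrt_le_sqrt ?_) (norm_nonneg _))
            rw [← hc]
            nlinarith
        refine (hX.eLpNorm_sub_condMean_le hU hp n _ _ (by positivity) hB).trans (le_of_eq ?_)
        congr 1; ring
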